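/- Let $F\colon\mathbb{R}^d\to\mathbb{R}^d$ be $L$-Lipschitz, let $G\colon\mathbb{R}^d\rightrightarrows\mathbb{R}^d$ be maximally monotone, let $\rho>0$, and let $F+G$ be maximally $\rho$-cohypomonotone, i.e. maximal (for inclusion of graphs) among the operators $A$ with $\langle u-v,x-y\rangle\ge-\rho\|u-v\|^2$ for all $u\in A(x)$, $v\in A(y)$. Let $x^\star$ satisfy $0\in F(x^\star)+G(x^\star)$. Let $F$ be accessed through a stochastic first-order oracle $\widetilde F$ with $\mathbb{E}[\widetilde F(x)]=F(x)$ and $\mathbb{E}\|\widetilde F(x)-F(x)\|^2\le\sigma^2$ for every $x$, every call using a fresh independent sample. Let $\rho<\eta<1/L$, $\alpha=1-\rho/\eta$, $\beta_k=\frac1{k+2}$, and write $J_A=(\mathrm{Id}+A)^{-1}$. Stochastic Halpern iteration: given $x_0\in\mathbb{R}^d$, for $k=0,1,2,\dots$ $$x_{k+1}=\beta_kx_0+(1-\beta_k)\big((1-\alpha)x_k+\alpha\widetilde J_k\big),$$ where $\widetilde J_k=z_{N_k}$ is the output of $N_k=\left\lceil\frac{1734(k+2)^3\log^2(k+2)}{(1-\eta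 L)^2}\right\rceil$ steps of stochastic forward-backward-forward (FBF) started at $z_0=x_k$: with $\widetilde B(z)=z+\eta\widetilde F(z)-x_k$ and $\tau_t=\frac{2}{(t+1)(1-\eta L)+6(1+\eta L)}$, $$z_{t+1/2}=J_{\tau_t\eta G}\big(z_t-\tau_t\widetilde B(z_t)\big),\qquad z_{t+1}=z_{t+1/2}+\tau_t\widetilde B(z_t)-\tau_t\widetilde B(z_{t+1/2}),$$ the same sample of $\widetilde B(z_t)$ being used in both formulas. Then $J:=J_{\eta(F+G)}$ and the resolvents of the positive multiples of $G$ are everywhere defined and single-valued, and: 1. For every $k\ge1$, $$\frac1{\eta^2}\,\mathbb{E}\|x_k-J(x_k)\|^2\le\frac{36\left(\|x_0-x^\star\|^2+\eta^2\sigma^2\right)}{(\eta-\rho)^2k^2}.$$ 2. Outer iteration $k$ uses at most $2\left\lceil\frac{1734(k+2)^3\log^2(k+2)}{(1-\eta L)^2}\right\rceil$ evaluations of $\widetilde F$, and at most half as many resolvents of positive multiples of $G$. 3. For every $\varepsilon>0$ there is $K\ge1$ such that the last iterate satisfies $\mathbb{E}\big[\eta^{-1}\|x_K-J(x_K)\|\big]\le\varepsilon$,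 and the total number of stochastic first-order oracle calls (evaluations of $\widetilde F$, and also resolvents of $G$) made up to $x_K$ is at most $$C\,\frac{1+Q}{(1-\eta L)^2}\,\log^2(2+Q),\qquad Q=\frac{\|x_0-x^\star\|^4+\eta^4\sigma^4}{(\eta-\rho)^4\varepsilon^4},$$ with a universal constant $C>0$; that is, $\widetilde O(\varepsilon^{-4})$ calls. -/

import Mathlib

open MeasureTheory ProbabilityTheory
open scoped NNReal ENNReal

/-- A set-valued operator `A : E ⇉ E` is given by its values `A x ⊆ E`; its graph is
`{(x, u) | u ∈ A x}`.  It is `ρ`-cohypomonotone if `⟨u - v, x - y⟩ ≥ -ρ ‖u - v‖²` on the graph. -/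
def IsCohypomonotone {E : Type*} [NormedAddCommGroup E] [InnerProductSpace ℝ E]
    (ρ : ℝ) (A : E → Set E) : Prop :=
  ∀ x y : E, ∀ u ∈ A x, ∀ v ∈ A y, -ρ * ‖u - v‖ ^ 2 ≤ inner ℝ (u - v) (x - y)

/-- Monotonicity of a set-valued operator. -/
def IsMonotoneOperator {E : Type*} [NormedAddCommGroup E] [InnerProductSpace ℝ E]
    (A : E → Set E) : Prop :=
  ∀ x y : E, ∀ u ∈ A x, ∀ v ∈ A y, 0 ≤ inner ℝ (u - v) (x - y)

/-- Maximality with respect to inclusion of graphs: the operator has the property `P`, and its graph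
is not strictly contained in the graph of an operator with the property `P`. -/
def IsMaximalOperator {E : Type*} (P : (E → Set E) → Prop) (A : E → Set E) : Prop :=
  P A ∧ ∀ A' : E → Set E, P A' → (∀ x, A x ⊆ A' x) → ∀ x, A' x ⊆ A x

/-- Maximally monotone operators. -/
def IsMaximallyMonotone {E : Type*} [NormedAddCommGroup E] [InnerProductSpace ℝ E]
    (A : E → Set E) : Prop :=
  IsMaximalOperator IsMonotoneOperator A

/-- Maximally `ρ`-cohypomonotone operators. -/
def IsMaximallyCohypomonotone {E : Type*} [NormedAddCommGroup E] [InnerProductSpace ℝ E]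
    (ρ : ℝ) (A : E → Set E) : Prop :=
  IsMaximalOperator (IsCohypomonotone ρ) A

/-- The operator `c A`. -/
def scaleOperator {E : Type*} [AddCommGroup E] [Module ℝ E]
    (c : ℝ) (A : E → Set E) : E → Set E :=
  fun x => {u | ∃ a ∈ A x, u = c • a}

/-- The operator `F + G` for a single-valued `F` and a set-valued `G`. -/
def sumOperator {E : Type*} [AddCommGroup E] (F : E → E) (G : E → Set E) : E → Set E :=
  fun x => {u | ∃ g ∈ G x, u = F x + g}

/-- `y` is a value of the resolvent `J_A = (Id + A)⁻¹` at `x`, that is, `x ∈ y + A y`. -/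
def IsResolventValue {E : Type*} [AddCommGroup E] (A : E → Set E) (x y : E) : Prop :=
  x - y ∈ A y

/-- The resolvent `J_A` as a function: `resolvent A x` is a solution `y` of `x ∈ y + A y`.
It is a meaningful value wherever there is exactly one such `y`. -/
noncomputable def operatorResolvent {E : Type*} [AddCommGroup E] (A : E → Set E) (x : E) : E :=
  Classical.epsilon fun y => IsResolventValue A x y

/-- A stochastic first-order oracle `Ft x s` (query point `x`, random seed `s ∼ P`) for `F`:
`E[Ft x] = F x` and `E ‖Ft x - F x‖² ≤ σ²` at every point `x`. -/
structure IsStochasticOracle {E S : Type*} [NormedAddCommGroup E] [NormedSpace ℝ E]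
    [MeasurableSpace E] [MeasurableSpace S] (P : Measure S) (F : E → E) (Ft : E → S → E)
    (σ : ℝ) : Prop where
  measurable : Measurable (Function.uncurry Ft)
  integrable : ∀ x, Integrable (Ft x) P
  unbiased : ∀ x, ∫ s, Ft x s ∂P = F x
  variance_le : ∀ x, ∫⁻ s, ‖Ft x s - F x‖ₑ ^ 2 ∂P ≤ ENNReal.ofReal (σ ^ 2)

/-- State of an algorithm with oracle access: the current point, the number of evaluations of the
stochastic oracle made so far, and the number of resolvent evaluations made so far. -/
structure OracleState (E : Type*) where
  point : E
  evals : ℕ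
  resolvents : ℕ

/-- One step of stochastic forward-backward-forward for `0 ∈ (A + B) z` with step size `τ`.  The
`n`-th evaluation of the stochastic oracle uses the `n`-th entry of the stream of seeds, so every
evaluation uses a fresh seed, and the value `Bt (z_t)` is drawn once and used twice. -/
noncomputable def fbfStep {E S : Type*} [AddCommGroup E] [Module ℝ E]
    (A : E → Set E) (Bt : E → S → E) (τ : ℝ) (seeds : ℕ → S) (z : OracleState E) :
    OracleState E :=
  let b : E := Bt z.point (seeds z.evals)
  let zHalf : E := operatorResolvent (scaleOperator τ A) (z.point - τ • b)
  let bHalf : E := Bt zHalf (seeds (z.evals + 1))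
  { point := zHalf + τ • b - τ • bHalf
    evals := z.evals + 2
    resolvents := z.resolvents + 1 }

/-- Stochastic forward-backward-forward from `z₀` after a number of steps, with
`Bt = BtIn - z₀` and step sizes `τ_t = 2 / ((t + 1) μ + 6 L_B)`. -/
noncomputable def stochasticFBF {E S : Type*} [AddCommGroup E] [Module ℝ E]
    (A : E → Set E) (BtIn : E → S → E) (LB μ : ℝ) (seeds : ℕ → S) (z₀ : OracleState E) :
    ℕ → OracleState E
  | 0 => z₀
  | t + 1 =>
      fbfStep A (fun z s => BtIn z s - z₀.point) (2 / (((t : ℝ) + 1) * μ + 6 * LB)) seeds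
        (stochasticFBF A BtIn LB μ seeds z₀ t)

/-- The number of inner steps `N_k = ⌈1734 (k + 2)³ log² (k + 2) / (1 - η L)²⌉`. -/
noncomputable def innerIterations (η L : ℝ) (k : ℕ) : ℕ :=
  ⌈1734 * ((k : ℝ) + 2) ^ 3 * Real.log ((k : ℝ) + 2) ^ 2 / (1 - η * L) ^ 2⌉₊

/-- Stochastic inexact Halpern iteration for `0 ∈ F x + G x` from `x₀`, with `β_k = 1 / (k + 2)`,
`α = 1 - ρ / η`: the state after `k` outer iterations, along a given stream of seeds. The resolvent
of `η (F + G)` at `x_k` is approximated by stochastic forward-backward-forward with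
`A = η G`, `BtIn = Id + η Ft`, `L_B = 1 + η L` and `μ = 1 - η L`. -/
noncomputable def stochasticHalpern {E S : Type*} [AddCommGroup E] [Module ℝ E]
    (G : E → Set E) (Ft : E → S → E) (η L ρ : ℝ) (x₀ : E) (seeds : ℕ → S) :
    ℕ → OracleState E
  | 0 => { point := x₀, evals := 0, resolvents := 0 }
  | k + 1 =>
      let x : OracleState E := stochasticHalpern G Ft η L ρ x₀ seeds k
      let J : OracleState E :=
        stochasticFBF (scaleOperator η G) (fun z s => z + η • Ft z s) (1 + η * L) (1 - η * L)
          seeds x (innerIterations η L k)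
      let β : ℝ := 1 / ((k : ℝ) + 2)
      let α : ℝ := 1 - ρ / η
      { point := β • x₀ + (1 - β) • ((1 - α) • x.point + α • J.point)
        evals := J.evals
        resolvents := J.resolvents }

/-! Put `R = α (Id - J)`. Cohypomonotonicity of `F + G` makes `R` firmly nonexpansive, so with `e =
α (J̃ - J x)` the outer loop is Halpern iteration `x' = β x₀ + (1 - β) (x - R x + e)` for a
nonexpansive map, perturbed by `e`. With `n = k + 1`, the potential `n (n - 1) / 2 ‖R x‖² + n ⟨R x,
x - x₀⟩` vanishes at the start and dominates `n (n + 1) / 4 ‖R x‖² - ‖x₀ - x⋆‖²`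
(`residual_le_halpern_potential`). Each step raises it by at most a multiple of `n² ‖e‖²` plus a
small multiple of `‖R x‖²` (`halpern_potential_step`).

The inner problem `0 ∈ y + η F y - x + η G y` is `(1 - η L)`-strongly monotone with a `(1 + η
L)`-Lipschitz single-valued part. Stochastic FBF therefore has expected squared error `O((‖x - J x‖²
+ η² σ²) / ((1 - η L)² N))` (`fbf_step_norm_sq_le`, `fbf_recursion_le`). The noise of the first
evaluation enters only quadratically, and that of the second is centred given the past, because
every evaluation uses a fresh seed (`integral_inner_noise`).

The inner error thus depends on the residual that is being bounded, and `halpern_recursion_le`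
breaks the circle by induction: with `N_k` of order `k³ log² k` the potential increments are at most
of order `1 / (k log² k) + 1 / k²`, which is summable. Hence `E ‖R x_k‖² = O(1 / k²)`. Taking `K` of
order `1 / ε` and summing the `N_k` gives `ε⁻⁴` calls up to logarithms. -/

/-! ### Algebra of resolvents. -/

section Resolvents

variable {E : Type*} [AddCommGroup E]

theorem isResolventValue_operatorResolvent {A : E → Set E} {x : E}
    (h : ∃ y, IsResolventValue A x y) : IsResolventValue A x (operatorResolvent A x) :=
  Classical.epsilon_spec h

theorem existsUnique_operatorResolvent_eq {A : E → Set E} {x y : E}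
    (h : ∃! y, IsResolventValue A x y) (hy : IsResolventValue A x y) :
    operatorResolvent A x = y :=
  h.unique (isResolventValue_operatorResolvent h.exists) hy

variable [Module ℝ E]

theorem scaleOperator_scaleOperator (a b : ℝ) (A : E → Set E) :
    scaleOperator a (scaleOperator b A) = scaleOperator (a * b) A := by
  funext x
  ext u
  constructor
  · rintro ⟨_, ⟨v, hv, rfl⟩, rfl⟩
    exact ⟨v, hv, by rw [mul_smul]⟩
  · rintro ⟨v, hv, rfl⟩
    exact ⟨b • v, ⟨v, hv, rfl⟩, by rw [mul_smul]⟩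

/-- Recasts the resolvent of the sum as the fixed-point equation `y = J_{ηG} (x - η F y)`, which is
a contraction when `η L < 1`. -/
theorem isResolventValue_scale_sumOperator_iff {F : E → E} {G : E → Set E} {η : ℝ} {x y : E} :
    IsResolventValue (scaleOperator η (sumOperator F G)) x y ↔
      IsResolventValue (scaleOperator η G) (x - η • F y) y := by
  constructor
  · rintro ⟨_, ⟨g, hg, rfl⟩, h⟩
    exact ⟨g, hg, by rw [sub_right_comm, h, smul_add]; abel⟩
  · rintro ⟨g, hg, h⟩
    exact ⟨_, ⟨g, hg, rfl⟩, by rw [smul_add, ← h]; abel⟩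

end Resolvents

/-! ### Minty's theorem, resolvents and cocoercivity. -/

section Operators

variable {E : Type*} [NormedAddCommGroup E] [InnerProductSpace ℝ E]

/-- Weighted averages of an antitone pairing: a Chebyshev-type inequality. -/
theorem sum_mul_inner_le_inner_sum {ι : Type*} [Fintype ι] (u z : ι → E)
    (h : ∀ i j, inner ℝ (u i - u j) (z i - z j) ≤ 0) (w : ι → ℝ) (hw : ∀ i, 0 ≤ w i)
    (hw1 : ∑ i, w i = 1) :
    ∑ i, w i * inner ℝ (u i) (z i) ≤ inner ℝ (∑ i, w i • u i) (∑ i, w i • z i) := by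
  have key : ∑ i, ∑ j, w i * w j * inner ℝ (u i - u j) (z i - z j) ≤ 0 :=
    Finset.sum_nonpos fun i _ => Finset.sum_nonpos fun j _ =>
      mul_nonpos_of_nonneg_of_nonpos (mul_nonneg (hw i) (hw j)) (h i j)
  have e : ∀ i j, w i * w j * inner ℝ (u i - u j) (z i - z j) =
      w j * (w i * inner ℝ (u i) (z i)) - inner ℝ (w i • u i) (w j • z j)
        - inner ℝ (w j • u j) (w i • z i) + w i * (w j * inner ℝ (u j) (z j)) := by
    intro i j
    simp only [inner_sub_left, inner_sub_right, real_inner_smul_left, real_inner_smul_right]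
    ring
  simp only [e, Finset.sum_add_distrib, Finset.sum_sub_distrib] at key
  simp only [← Finset.sum_mul, ← Finset.mul_sum, ← inner_sum, ← sum_inner, hw1, one_mul] at key
  linarith

/-- Finitely many balls with diameters `[u i, z i]` have a common point if the pairing is
antitone. -/
theorem exists_forall_inner_sub_nonpos {ι : Type*} [Fintype ι] [Nonempty ι] (u z : ι → E)
    (h : ∀ i j, inner ℝ (u i - u j) (z i - z j) ≤ 0) :
    ∃ y : E, ∀ i, inner ℝ (y - u i) (y - z i) ≤ 0 := by
  classical
  let m : ι → E := fun i => (1 / 2 : ℝ) • (u i + z i)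
  -- Dual of minimising `max_i ⟨y - u i, y - z i⟩` over `y`: `φ w` is the minimum over `y` of the
  -- `w`-average of these products, attained at `∑ w i • m i`.
  let φ : (ι → ℝ) → ℝ := fun w => ∑ i, w i * inner ℝ (u i) (z i) - ‖∑ i, w i • m i‖ ^ 2
  have hφ : Continuous φ := by fun_prop
  obtain ⟨w, hw, hmax⟩ := (isCompact_stdSimplex ℝ ι).exists_isMaxOn
    ⟨_, single_mem_stdSimplex ℝ (Classical.arbitrary ι)⟩ hφ.continuousOn
  set y : E := ∑ i, w i • m i with hy
  refine ⟨y, fun j => ?_⟩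
  have hyuz : y = (1 / 2 : ℝ) • (∑ i, w i • u i + ∑ i, w i • z i) := by
    simp only [hy, m, ← Finset.sum_add_distrib, Finset.smul_sum]
    refine Finset.sum_congr rfl fun i _ => ?_
    module
  have hneg : ∑ i, w i * inner ℝ (u i) (z i) - ‖y‖ ^ 2 ≤ 0 := by
    have h1 := sum_mul_inner_le_inner_sum u z h w hw.1 hw.2
    have h2 : inner ℝ (∑ i, w i • u i) (∑ i, w i • z i) ≤ ‖y‖ ^ 2 := by
      rw [hyuz, norm_smul, mul_pow, norm_add_sq_real]
      have := norm_sub_sq_real (∑ i, w i • u i) (∑ i, w i • z i)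
      norm_num
      nlinarith [sq_nonneg ‖∑ i, w i • u i - ∑ i, w i • z i‖]
    linarith
  -- First-order optimality of `w` towards the vertex `j`: as `s → 0` it yields `⟨y - u j, y - z j⟩
  -- ≤ φ w ≤ 0`.
  have hpert : ∀ s : ℝ, 0 < s → s ≤ 1 →
      inner ℝ (u j) (z j) - ∑ i, w i * inner ℝ (u i) (z i) - 2 * inner ℝ y (m j - y) ≤
        s * ‖m j - y‖ ^ 2 := by
    intro s hs hs1
    let v : ι → ℝ := (1 - s) • w + s • Pi.single j 1
    have hmem : v ∈ stdSimplex ℝ ι :=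
      convex_stdSimplex ℝ ι hw (single_mem_stdSimplex ℝ j) (by linarith) hs.le (by ring)
    have := hmax hmem
    have e1 : ∑ i, v i * inner ℝ (u i) (z i) =
        (1 - s) * ∑ i, w i * inner ℝ (u i) (z i) + s * inner ℝ (u j) (z j) := by
      simp [v, add_mul, Finset.sum_add_distrib, Finset.mul_sum, mul_assoc, Pi.single_apply]
    have e2 : ∑ i, v i • m i = y + s • (m j - y) := by
      have : ∑ i, v i • m i = (1 - s) • y + s • m j := by
        simp [v, add_smul, Finset.sum_add_distrib, Finset.smul_sum, mul_smul, Pi.single_apply, hy]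
      rw [this]; module
    simp only [φ, Set.mem_ofPred_eq, e1, e2, ← hy] at this
    rw [norm_add_sq_real, norm_smul, real_inner_smul_right, mul_pow, Real.norm_eq_abs, sq_abs]
      at this
    have h3 : s * (inner ℝ (u j) (z j) - ∑ i, w i * inner ℝ (u i) (z i)
        - 2 * inner ℝ y (m j - y)) ≤ s * (s * ‖m j - y‖ ^ 2) := by nlinarith
    exact le_of_mul_le_mul_left h3 hs
  have hlim : inner ℝ (u j) (z j) - ∑ i, w i * inner ℝ (u i) (z i) - 2 * inner ℝ y (m j - y)
      ≤ 0 := by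
    by_contra! hc
    set c := inner ℝ (u j) (z j) - ∑ i, w i * inner ℝ (u i) (z i) - 2 * inner ℝ y (m j - y)
    have hn := sq_nonneg ‖m j - y‖
    set n := ‖m j - y‖ ^ 2
    have h1 := hpert (min 1 (c / (2 * (n + 1)))) (by positivity) (min_le_left _ _)
    have h2 : min 1 (c / (2 * (n + 1))) * n ≤ c / (2 * (n + 1)) * (n + 1) :=
      mul_le_mul (min_le_right _ _) (by linarith) hn (by positivity)
    have h3 : c / (2 * (n + 1)) * (n + 1) = c / 2 := by field_simp
    linarith
  have e3 : inner ℝ (y - u j) (y - z j) =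
      ‖y‖ ^ 2 - 2 * inner ℝ y (m j) + inner ℝ (u j) (z j) := by
    simp only [m, inner_sub_left, inner_sub_right, real_inner_smul_right, inner_add_right,
      real_inner_self_eq_norm_sq, real_inner_comm y (u j)]
    ring
  rw [inner_sub_right, real_inner_self_eq_norm_sq] at hlim
  rw [e3]
  linarith

/-- Minty's theorem: the resolvent of a positive multiple of a maximally monotone operator is
everywhere defined. -/
theorem IsMaximallyMonotone.exists_isResolventValue [FiniteDimensional ℝ E] {G : E → Set E}
    (hG : IsMaximallyMonotone G) {c : ℝ} (hc : 0 < c) (x : E) :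
    ∃ y, IsResolventValue (scaleOperator c G) x y := by
  let Γ := {p : E × E // p.2 ∈ G p.1}
  -- `K (z, w)` is the ball with diameter `[x - c w, z]`. It consists of the `y` for which `(y, c⁻¹
  -- (x - y))` is monotonically related to `(z, w)`, so a common point can be adjoined to the graph
  -- and lies in it by maximality.
  let K : Γ → Set E := fun p => {y | inner ℝ (y - (x - c • p.1.2)) (y - p.1.1) ≤ 0}
  have hcl : ∀ p, IsClosed (K p) := fun p => isClosed_le (by fun_prop) continuous_const
  have hcpt : ∀ p, IsCompact (K p) := by
    intro p
    refine (isCompact_closedBall p.1.1 ‖(x - c • p.1.2) - p.1.1‖).of_isClosed_subset (hcl p) ?_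
    intro y hy
    rw [mem_closedBall_iff_norm]
    have h1 : inner ℝ (y - (x - c • p.1.2)) (y - p.1.1) ≤ 0 := hy
    have e : y - (x - c • p.1.2) = (y - p.1.1) - ((x - c • p.1.2) - p.1.1) := by abel
    rw [e, inner_sub_left, real_inner_self_eq_norm_sq] at h1
    have h2 := real_inner_le_norm ((x - c • p.1.2) - p.1.1) (y - p.1.1)
    by_contra! hlt
    nlinarith [norm_nonneg ((x - c • p.1.2) - p.1.1)]
  have hfin : ∀ s : Finset Γ, s.Nonempty → (⋂ p ∈ s, K p).Nonempty := by
    intro s hs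
    have : Nonempty s := hs.to_subtype
    obtain ⟨y, hy⟩ := exists_forall_inner_sub_nonpos
      (fun p : s => x - c • p.1.1.2) (fun p : s => p.1.1.1) (by
        intro p q
        have := hG.1 p.1.1.1 q.1.1.1 p.1.1.2 p.1.2 q.1.1.2 q.1.2
        have e : x - c • p.1.1.2 - (x - c • q.1.1.2) = (-c) • (p.1.1.2 - q.1.1.2) := by module
        rw [e, real_inner_smul_left]
        nlinarith)
    exact ⟨y, Set.mem_iInter₂.2 fun p hp => hy ⟨p, hp⟩⟩
  have hall : ∃ y, ∀ p, y ∈ K p := by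
    by_cases hΓ : Nonempty Γ
    · classical
      obtain ⟨p₀⟩ := hΓ
      obtain ⟨y, -, hy⟩ := (hcpt p₀).inter_iInter_nonempty K hcl (by
        intro s
        obtain ⟨y, hy⟩ := hfin (insert p₀ s) (Finset.insert_nonempty _ _)
        rw [Set.mem_iInter₂] at hy
        exact ⟨y, hy p₀ (Finset.mem_insert_self _ _),
          Set.mem_iInter₂.2 fun p hp => hy p (Finset.mem_insert_of_mem hp)⟩)
      exact ⟨y, Set.mem_iInter.1 hy⟩
    · exact ⟨0, fun p => (hΓ ⟨p⟩).elim⟩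
  obtain ⟨y, hy⟩ := hall
  have hrel : ∀ z, ∀ w ∈ G z, 0 ≤ inner ℝ (c⁻¹ • (x - y) - w) (y - z) := by
    intro z w hw
    have h1 : inner ℝ (y - (x - c • w)) (y - z) ≤ 0 := hy ⟨(z, w), hw⟩
    have e : c⁻¹ • (x - y) - w = (-c⁻¹) • (y - (x - c • w)) := by
      have : w = c⁻¹ • c • w := by rw [smul_smul, inv_mul_cancel₀ hc.ne', one_smul]
      nth_rewrite 1 [this]
      module
    rw [e, real_inner_smul_left]
    have := inv_pos.2 hc
    nlinarith
  have hmem := hG.2 (fun z => G z ∪ {v | z = y ∧ v = c⁻¹ • (x - y)}) (by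
    rintro a b u (hu | ⟨rfl, rfl⟩) v (hv | ⟨rfl, rfl⟩)
    · exact hG.1 a b u hu v hv
    · have := hrel a u hu
      rwa [← neg_sub, ← neg_sub (b : E) a, inner_neg_neg]
    · exact hrel b v hv
    · simp) (fun z => Set.subset_union_left) y (Or.inr ⟨rfl, rfl⟩)
  refine ⟨y, c⁻¹ • (x - y), hmem, ?_⟩
  rw [smul_smul, mul_inv_cancel₀ hc.ne', one_smul]

theorem IsMonotoneOperator.scale {A : E → Set E} (hA : IsMonotoneOperator A) {c : ℝ}
    (hc : 0 ≤ c) : IsMonotoneOperator (scaleOperator c A) := by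
  rintro x y _ ⟨u, hu, rfl⟩ _ ⟨v, hv, rfl⟩
  rw [← smul_sub, real_inner_smul_left]
  exact mul_nonneg hc (hA x y u hu v hv)

/-- Resolvents of monotone operators are nonexpansive. -/
theorem IsMonotoneOperator.norm_sub_le_of_isResolventValue {A : E → Set E}
    (hA : IsMonotoneOperator A) {x x' y y' : E} (h : IsResolventValue A x y)
    (h' : IsResolventValue A x' y') : ‖y - y'‖ ≤ ‖x - x'‖ := by
  have h1 := hA y y' _ h _ h'
  have e : x - y - (x' - y') = (x - x') - (y - y') := by abel
  rw [e, inner_sub_left, real_inner_self_eq_norm_sq] at h1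
  have h2 := real_inner_le_norm (x - x') (y - y')
  by_contra! hlt
  nlinarith [norm_nonneg (x - x')]

theorem IsMaximallyMonotone.existsUnique_isResolventValue [FiniteDimensional ℝ E]
    {G : E → Set E} (hG : IsMaximallyMonotone G) {c : ℝ} (hc : 0 < c) (x : E) :
    ∃! y, IsResolventValue (scaleOperator c G) x y := by
  obtain ⟨y, hy⟩ := hG.exists_isResolventValue hc x
  refine ⟨y, hy, fun y' hy' => ?_⟩
  have := (hG.1.scale hc.le).norm_sub_le_of_isResolventValue hy' hy
  rw [sub_self, norm_zero] at this
  exact sub_eq_zero.1 (norm_le_zero_iff.1 this)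

theorem IsMaximallyMonotone.lipschitzWith_operatorResolvent [FiniteDimensional ℝ E]
    {G : E → Set E} (hG : IsMaximallyMonotone G) {c : ℝ} (hc : 0 < c) :
    LipschitzWith 1 (operatorResolvent (scaleOperator c G)) := by
  refine LipschitzWith.of_dist_le_mul fun x x' => ?_
  rw [NNReal.coe_one, one_mul, dist_eq_norm, dist_eq_norm]
  exact (hG.1.scale hc.le).norm_sub_le_of_isResolventValue
    (isResolventValue_operatorResolvent (hG.exists_isResolventValue hc x))
    (isResolventValue_operatorResolvent (hG.exists_isResolventValue hc x'))

/-- The resolvent of `η (F + G)` for `F` Lipschitz with constant less than `1 / η`. -/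
theorem IsMaximallyMonotone.existsUnique_isResolventValue_sumOperator [FiniteDimensional ℝ E]
    {F : E → E} {G : E → Set E} {L : ℝ≥0} (hF : LipschitzWith L F) (hG : IsMaximallyMonotone G)
    {η : ℝ} (hη : 0 < η) (hηL : η * L < 1) (x : E) :
    ∃! y, IsResolventValue (scaleOperator η (sumOperator F G)) x y := by
  simp only [isResolventValue_scale_sumOperator_iff]
  let r := operatorResolvent (scaleOperator η G)
  have hr : ∀ v, IsResolventValue (scaleOperator η G) v (r v) := fun v =>
    isResolventValue_operatorResolvent (hG.exists_isResolventValue hη v)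
  have hlip : ∀ y y', ‖(x - η • F y) - (x - η • F y')‖ ≤ η * L * ‖y - y'‖ := by
    intro y y'
    have e : (x - η • F y) - (x - η • F y') = η • (F y' - F y) := by module
    rw [e, norm_smul, Real.norm_of_nonneg hη.le, mul_assoc, norm_sub_rev]
    exact mul_le_mul_of_nonneg_left (hF.norm_sub_le y y') hη.le
  have hcontr : ContractingWith ⟨η * L, by positivity⟩ (fun y => r (x - η • F y)) := by
    refine ⟨by exact_mod_cast hηL, LipschitzWith.of_dist_le_mul fun y y' => ?_⟩
    rw [dist_eq_norm, dist_eq_norm]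
    exact ((hG.1.scale hη.le).norm_sub_le_of_isResolventValue (hr _) (hr _)).trans (hlip y y')
  have hfix := hcontr.fixedPoint_isFixedPt
  refine ⟨hcontr.fixedPoint, ?_, fun y' hy' => ?_⟩
  · have := hr (x - η • F hcontr.fixedPoint)
    rwa [show r (x - η • F hcontr.fixedPoint) = hcontr.fixedPoint from hfix] at this
  · exact hcontr.fixedPoint_unique
      (((hG.existsUnique_isResolventValue hη _).unique (hr _) hy'))

/-- Cocoercivity of `Id - J` for the resolvent `J` of a multiple of a cohypomonotone operator. -/
theorem IsCohypomonotone.cocoercive_sub_resolvent {T : E → Set E} {ρ η : ℝ}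
    (hT : IsCohypomonotone ρ T) (hη : 0 < η) {x x' y y' : E}
    (h : IsResolventValue (scaleOperator η T) x y)
    (h' : IsResolventValue (scaleOperator η T) x' y') :
    (1 - ρ / η) * ‖(x - y) - (x' - y')‖ ^ 2 ≤ inner ℝ ((x - y) - (x' - y')) (x - x') := by
  obtain ⟨u, hu, e⟩ := h
  obtain ⟨v, hv, e'⟩ := h'
  have h1 := hT y y' u hu v hv
  have e2 : x - x' = η • (u - v) + (y - y') := by
    rw [smul_sub, ← e, ← e']; abel
  rw [e, e', e2, ← smul_sub, inner_add_right, real_inner_self_eq_norm_sq, real_inner_smul_left,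
    norm_smul, Real.norm_of_nonneg hη.le, mul_pow]
  have : (1 - ρ / η) * (η ^ 2 * ‖u - v‖ ^ 2) =
      η ^ 2 * ‖u - v‖ ^ 2 + η * (-ρ * ‖u - v‖ ^ 2) := by field_simp; ring
  rw [this]
  gcongr

end Operators

/-! ### Pathwise inequalities for Halpern and FBF steps. -/

section Deterministic

variable {E : Type*} [NormedAddCommGroup E] [InnerProductSpace ℝ E]

/-- Decrease of the Halpern potential, with an error `e` in the step. -/
theorem halpern_potential_step {s s' a a' e : E} {n : ℝ} (hn : 0 < n)
    (ha : a' = (n / (n + 1)) • (a - s + e)) (hs : ‖s' - s‖ ^ 2 ≤ inner ℝ (s' - s) (a' - a)) :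
    n * (n + 1) / 2 * ‖s'‖ ^ 2 + (n + 1) * inner ℝ s' a' ≤
      (n - 1) * n / 2 * ‖s‖ ^ 2 + n * inner ℝ s a + 5 * (n * (n + 1)) * ‖e‖ ^ 2
        + n / (n + 1) / 18 * ‖s‖ ^ 2 := by
  have hN : (0 : ℝ) < n + 1 := by linarith
  have h1 : n * (n + 1) / 2 * ‖s'‖ ^ 2 + (n + 1) * inner ℝ s' a' ≤
      (n - 1) * n / 2 * ‖s‖ ^ 2 + n * inner ℝ s a + n * (n + 1) / 2 * ‖e‖ ^ 2
        + n * inner ℝ e s := by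
    -- The gap between the two sides is exactly `h2 + h3`: weighted cocoercivity plus a square.
    have h2 : 0 ≤ n * (n + 1) * (inner ℝ (s' - s) (a' - a) - ‖s' - s‖ ^ 2) :=
      mul_nonneg (by positivity) (by linarith)
    have h3 : 0 ≤ n * (n + 1) / 2 * ‖s' - s - e‖ ^ 2 := by positivity
    rw [← sub_nonneg]
    refine (add_nonneg h2 h3).trans_eq ?_
    simp only [ha, ← real_inner_self_eq_norm_sq, inner_sub_left, inner_sub_right, inner_add_right,
      real_inner_smul_right]
    rw [real_inner_comm s' s, real_inner_comm s e, real_inner_comm s' e]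
    field_simp
    ring
  -- Young's inequality, weighted so that the residual gets only the factor `1 / 18`; the error
  -- coefficient becomes `1 / 2 + 9 / 2 = 5`.
  have h4 : inner ℝ e s ≤ 9 / 2 * (n + 1) * ‖e‖ ^ 2 + 1 / (18 * (n + 1)) * ‖s‖ ^ 2 := by
    refine (real_inner_le_norm e s).trans ?_
    have : 9 / 2 * (n + 1) * ‖e‖ ^ 2 + 1 / (18 * (n + 1)) * ‖s‖ ^ 2 - ‖e‖ * ‖s‖ =
        (9 * (n + 1) * ‖e‖ - ‖s‖) ^ 2 / (18 * (n + 1)) := by field_simp; ring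
    have h5 : 0 ≤ (9 * (n + 1) * ‖e‖ - ‖s‖) ^ 2 / (18 * (n + 1)) := by positivity
    linarith
  have h6 := mul_le_mul_of_nonneg_left h4 hn.le
  have h7 : n * (9 / 2 * (n + 1) * ‖e‖ ^ 2 + 1 / (18 * (n + 1)) * ‖s‖ ^ 2) =
      9 / 2 * (n * (n + 1)) * ‖e‖ ^ 2 + n / (n + 1) / 18 * ‖s‖ ^ 2 := by field_simp
  linarith

/-- The Halpern potential controls the residual; `c` is the start minus the zero. -/
theorem residual_le_halpern_potential {s a c : E} {n : ℝ} (hn : 0 < n)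
    (hs : ‖s‖ ^ 2 ≤ inner ℝ s (a + c)) :
    n * (n + 1) / 4 * ‖s‖ ^ 2 ≤ ‖c‖ ^ 2 + ((n - 1) * n / 2 * ‖s‖ ^ 2 + n * inner ℝ s a) := by
  rw [inner_add_right] at hs
  have h1 := real_inner_le_norm s c
  have h2 := mul_le_mul_of_nonneg_left (hs.trans (add_le_add_right h1 _)) hn.le
  have h3 : 0 ≤ n * ((n + 1) * ‖s‖ - 2 * ‖c‖) ^ 2 / (4 * (n + 1)) := by positivity
  have h4 : n * ((n + 1) * ‖s‖ - 2 * ‖c‖) ^ 2 / (4 * (n + 1)) =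
      n * (n + 1) / 4 * ‖s‖ ^ 2 - n * (‖s‖ * ‖c‖) + ‖c‖ ^ 2 - ‖c‖ ^ 2 / (n + 1) := by
    field_simp; ring
  have h5 : 0 ≤ ‖c‖ ^ 2 / (n + 1) := by positivity
  nlinarith

/-- One step of forward-backward-forward with noise `ν`, `ν'` in the two evaluations. -/
theorem fbf_step_norm_sq_le {z h zs Bz Bh Bs ν ν' : E} {τ μ LB : ℝ} (hτ : 0 < τ) (hμ : 0 ≤ μ)
    (hμL : μ ≤ LB) (hτL : 3 * τ * LB ≤ 1)
    (hmono : 0 ≤ inner ℝ ((z - τ • (Bz + ν) - h) + τ • Bs) (h - zs))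
    (hstrong : μ * ‖h - zs‖ ^ 2 ≤ inner ℝ (Bh - Bs) (h - zs))
    (hlip : ‖Bz - Bh‖ ≤ LB * ‖z - h‖) :
    ‖(h + τ • (Bz + ν) - τ • (Bh + ν')) - zs‖ ^ 2 ≤
      (1 - τ * μ) * ‖z - zs‖ ^ 2 - 2 * τ * inner ℝ ν' (h - zs)
        + 3 * τ ^ 2 * (‖ν‖ ^ 2 + ‖ν'‖ ^ 2) := by
  have hLB : 0 ≤ LB := hμ.trans hμL
  set w : E := (Bz - Bh) + (ν - ν') with hw
  have e1 : (h + τ • (Bz + ν) - τ • (Bh + ν')) - zs = (h - zs) + τ • w := by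
    rw [hw]; module
  have e2 : ‖z - zs‖ ^ 2 = ‖z - h‖ ^ 2 + 2 * inner ℝ (z - h) (h - zs) + ‖h - zs‖ ^ 2 := by
    rw [← norm_add_sq_real, sub_add_sub_cancel]
  -- Here `ν` is absorbed into `w`, so that `ν'` alone survives to first order.
  have e3 : inner ℝ ((z - τ • (Bz + ν) - h) + τ • Bs) (h - zs) =
      inner ℝ (z - h) (h - zs) - τ * inner ℝ w (h - zs) - τ * inner ℝ (Bh - Bs) (h - zs)
        - τ * inner ℝ ν' (h - zs) := by
    rw [← real_inner_smul_left, ← real_inner_smul_left, ← real_inner_smul_left, ← inner_sub_left,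
      ← inner_sub_left, ← inner_sub_left]
    congr 1
    rw [hw]; module
  have hwn : ‖w‖ ^ 2 ≤ 3 * (LB ^ 2 * ‖z - h‖ ^ 2 + ‖ν‖ ^ 2 + ‖ν'‖ ^ 2) := by
    have h1 : ‖w‖ ≤ LB * ‖z - h‖ + ‖ν‖ + ‖ν'‖ := by
      have := norm_add_le (Bz - Bh) (ν - ν')
      have := norm_sub_le ν ν'
      linarith
    have h2 : ‖w‖ ^ 2 ≤ (LB * ‖z - h‖ + ‖ν‖ + ‖ν'‖) ^ 2 := by gcongr
    nlinarith [sq_nonneg (LB * ‖z - h‖ - ‖ν‖), sq_nonneg (LB * ‖z - h‖ - ‖ν'‖),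
      sq_nonneg (‖ν‖ - ‖ν'‖)]
  have hwn' := mul_le_mul_of_nonneg_left hwn (sq_nonneg τ)
  -- Of the available `-‖z - h‖²`, one third pays for the Lipschitz term of `τ² ‖w‖²` and two thirds
  -- for replacing `2 τ μ ‖h - zs‖²` by `τ μ ‖z - zs‖²`.
  have hτL2 : 3 * τ ^ 2 * LB ^ 2 ≤ 1 / 3 := by
    have : (3 * τ * LB) ^ 2 ≤ 1 := pow_le_one₀ (by positivity) hτL
    nlinarith
  have hτμ : 3 * (τ * μ) ≤ 1 := by nlinarith
  have hzz : ‖z - zs‖ ^ 2 ≤ 2 * ‖z - h‖ ^ 2 + 2 * ‖h - zs‖ ^ 2 := by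
    have h1 : ‖z - zs‖ ≤ ‖z - h‖ + ‖h - zs‖ := norm_sub_le_norm_sub_add_norm_sub z h zs
    have h2 : ‖z - zs‖ ^ 2 ≤ (‖z - h‖ + ‖h - zs‖) ^ 2 := by gcongr
    nlinarith [sq_nonneg (‖z - h‖ - ‖h - zs‖)]
  have p1 := mul_le_mul_of_nonneg_left hzz (mul_nonneg hτ.le hμ)
  have p2 := mul_le_mul_of_nonneg_left hstrong hτ.le
  have p3 := mul_le_mul_of_nonneg_right hτL2 (sq_nonneg ‖z - h‖)
  have p4 := mul_le_mul_of_nonneg_right hτμ (sq_nonneg ‖z - h‖)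
  rw [e1, norm_add_sq_real, real_inner_smul_right, norm_smul, mul_pow, Real.norm_eq_abs, sq_abs,
    real_inner_comm]
  rw [e3] at hmono
  nlinarith

end Deterministic

/-! ### Real recursions and series. -/

section Numeric

/-- Rate of the recursion of stochastic forward-backward-forward. -/
theorem fbf_recursion_le {d : ℕ → ℝ} {μ LB s : ℝ} (hμ : 0 < μ) (hμL : μ + LB = 2) (hμ1 : μ ≤ 1)
    (hs : 0 ≤ s) (hd0 : 0 ≤ d 0)
    (hd : ∀ t : ℕ, d (t + 1) ≤ (1 - 2 / (((t : ℝ) + 1) * μ + 6 * LB) * μ) * d t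
      + 6 * (2 / (((t : ℝ) + 1) * μ + 6 * LB)) ^ 2 * s) {N : ℕ} (hN : 1 ≤ N) :
    d N ≤ (3 * d 0 + 24 * s) / (μ ^ 2 * N) := by
  set κ : ℝ := 6 * LB / μ with hκ
  have hκ6 : 6 ≤ κ := by rw [hκ, le_div_iff₀ hμ]; linarith
  have hLB : LB = κ * μ / 6 := by rw [hκ]; field_simp
  -- Since `τ_t = 2 / (μ (t + 1 + κ))`, the contraction factor is `(t + κ - 1) / (t + κ + 1)`, and
  -- the weight `(t + κ) (t + κ - 1)` makes the recursion telescope.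
  have key : ∀ t : ℕ, (t + κ) * (t + κ - 1) * d t ≤ κ * (κ - 1) * d 0 + 24 * s / μ ^ 2 * t := by
    intro t
    induction t with
    | zero => simp
    | succ t ih =>
      have ht : (0 : ℝ) ≤ t := t.cast_nonneg
      have hm : (0 : ℝ) < t + 1 + κ := by linarith
      have hm' : (0 : ℝ) ≤ t + κ := by linarith
      have h1 := mul_le_mul_of_nonneg_left (hd t) (mul_nonneg hm.le hm')
      have e1 : ((t : ℝ) + 1) * μ + 6 * LB = μ * (t + 1 + κ) := by rw [hLB]; ring
      rw [e1] at h1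
      have e2 : ((t : ℝ) + 1 + κ) * (t + κ) * ((1 - 2 / (μ * (t + 1 + κ)) * μ) * d t
          + 6 * (2 / (μ * (t + 1 + κ))) ^ 2 * s) =
          (t + κ) * (t + κ - 1) * d t + 24 * s / μ ^ 2 * ((t + κ) / (t + 1 + κ)) := by
        field_simp; ring
      rw [e2] at h1
      have h2 : ((t : ℝ) + κ) / (t + 1 + κ) ≤ 1 := by rw [div_le_one hm]; linarith
      have h3 : 24 * s / μ ^ 2 * ((t + κ) / (t + 1 + κ)) ≤ 24 * s / μ ^ 2 * 1 :=
        mul_le_mul_of_nonneg_left h2 (by positivity)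
      push_cast
      have e3 : ((t : ℝ) + 1 + κ) * (t + 1 + κ - 1) * d (t + 1) =
        (t + 1 + κ) * (t + κ) * d (t + 1) := by ring
      rw [e3]
      linarith
  have hN1 : (1 : ℝ) ≤ N := by exact_mod_cast hN
  have hD : (0 : ℝ) < (N + κ) * (N + κ - 1) := mul_pos (by linarith) (by linarith)
  have hp : 0 < μ ^ 2 * N := by positivity
  rw [le_div_iff₀ hp]
  have h1 : d N * (μ ^ 2 * N) * ((N + κ) * (N + κ - 1)) ≤
      (3 * d 0 + 24 * s) * ((N + κ) * (N + κ - 1)) := by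
    have h2 := mul_le_mul_of_nonneg_right (key N) hp.le
    have hκμ : κ * μ ^ 2 ≤ 12 := by
      have : κ * μ = 6 * LB := by rw [hLB]; ring
      nlinarith
    -- Reduces to `4 N (κ - 1) ≤ (N + κ) (N + κ - 1)`, a form of AM-GM.
    have h3 : κ * (κ - 1) * (μ ^ 2 * N) ≤ 3 * ((N + κ) * (N + κ - 1)) := by
      have : κ * (κ - 1) * (μ ^ 2 * N) = (κ * μ ^ 2) * ((κ - 1) * N) := by ring
      have h4 : (κ * μ ^ 2) * ((κ - 1) * N) ≤ 12 * ((κ - 1) * N) :=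
        mul_le_mul_of_nonneg_right hκμ (mul_nonneg (by linarith) (by linarith))
      nlinarith [sq_nonneg (N - κ + 3 / 2)]
    have h5 : (24 * s / μ ^ 2 * N) * (μ ^ 2 * N) = 24 * s * (N * N) := by field_simp
    have h6 : 24 * s * (N * N : ℝ) ≤ 24 * s * ((N + κ) * (N + κ - 1)) := by
      refine mul_le_mul_of_nonneg_left ?_ (by positivity)
      nlinarith
    have h7 := mul_le_mul_of_nonneg_right h3 hd0
    nlinarith
  exact le_of_mul_le_mul_right h1 hD

theorem sum_inv_add_two_sq_le (k : ℕ) :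
    ∑ j ∈ Finset.range k, 1 / ((j : ℝ) + 2) ^ 2 ≤ 1 - 1 / ((k : ℝ) + 1) := by
  induction k with
  | zero => simp
  | succ k ih =>
    rw [Finset.sum_range_succ]
    have hk : (0 : ℝ) ≤ k := k.cast_nonneg
    have h : 1 / ((k : ℝ) + 2) ^ 2 ≤ 1 / ((k : ℝ) + 1) - 1 / ((k : ℝ) + 2) := by
      rw [div_sub_div _ _ (by positivity) (by positivity), div_le_div_iff₀ (by positivity)
        (by positivity)]
      nlinarith
    push_cast
    rw [show (k : ℝ) + 1 + 1 = k + 2 by ring]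
    linarith

/-- Discrete form of `(-1 / log x)' = 1 / (x log² x)`, which makes the logarithmic series telescope.
-/
theorem inv_mul_log_sq_le {x : ℝ} (hx : 2 ≤ x) :
    1 / ((x + 1) * Real.log (x + 1) ^ 2) ≤ 1 / Real.log x - 1 / Real.log (x + 1) := by
  have hx0 : 0 < x := by linarith
  have ha : 0 < Real.log x := Real.log_pos (by linarith)
  have hab : Real.log x ≤ Real.log (x + 1) := Real.log_le_log hx0 (by linarith)
  have hd : 1 / (x + 1) ≤ Real.log (x + 1) - Real.log x := by
    rw [← Real.log_div (by linarith) hx0.ne']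
    refine le_trans (le_of_eq ?_) (Real.one_sub_inv_le_log_of_pos (by positivity))
    field_simp; ring
  set a := Real.log x
  set b := Real.log (x + 1)
  have hb : 0 < b := ha.trans_le hab
  have e : 1 / a - 1 / b = (b - a) / (a * b) := by field_simp
  rw [e, ← div_div]
  exact div_le_div₀ (by have : 0 < 1 / (x + 1) := by positivity
                        linarith) hd (by positivity) (by nlinarith)

theorem sum_inv_mul_log_sq_le (k : ℕ) :
    ∑ j ∈ Finset.range k, 1 / (((j : ℝ) + 2) * Real.log ((j : ℝ) + 2) ^ 2) ≤ 5 / 2 := by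
  have hl : (0.6931 : ℝ) < Real.log 2 := by have := Real.log_two_gt_d9; linarith
  have h : ∀ k : ℕ,
      ∑ j ∈ Finset.range (k + 1), 1 / (((j : ℝ) + 2) * Real.log ((j : ℝ) + 2) ^ 2) ≤
        -- The constant covers the first term together with the telescoping bound: `1 / (2 log² 2) +
        -- 1 / log 2 < 2.49`.
        5 / 2 - 1 / Real.log ((k : ℝ) + 2) := by
    intro k
    induction k with
    | zero =>
      simp only [zero_add, Finset.sum_range_one, Nat.cast_zero]
      have h1 : 1 / (2 * Real.log 2 ^ 2) ≤ 1 / (2 * 0.6931 ^ 2) := by gcongr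
      have h2 : 1 / Real.log 2 ≤ 1 / 0.6931 := by gcongr
      norm_num at h1 h2 ⊢
      linarith
    | succ k ih =>
      rw [Finset.sum_range_succ]
      have := inv_mul_log_sq_le (x := (k : ℝ) + 2) (by have := k.cast_nonneg (α := ℝ); linarith)
      push_cast
      rw [show (k : ℝ) + 1 + 2 = k + 2 + 1 by ring]
      linarith
  cases k with
  | zero => norm_num
  | succ k =>
    have hk : (0 : ℝ) ≤ k := k.cast_nonneg
    have : 0 ≤ 1 / Real.log ((k : ℝ) + 2) := one_div_nonneg.2 (Real.log_nonneg (by linarith))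
    linarith [h k]

/-- The recursion for the expected Halpern potentials `V` and squared residuals `M`, with expected
squared errors `e`. -/
theorem halpern_recursion_le {M V e : ℕ → ℝ} {D s : ℝ} (hD : 0 ≤ D) (hs : 0 ≤ s)
    (hV0 : V 0 = 0)
    (hV : ∀ k : ℕ, V (k + 1) ≤ V k + 5 * (((k : ℝ) + 1) * (k + 2)) * e k
      + (k + 1) / (k + 2) / 18 * M k)
    (hM : ∀ k : ℕ, ((k : ℝ) + 1) * (k + 2) / 4 * M k ≤ D + V k)
    (he : ∀ k : ℕ, e k ≤
      (3 * M k + 24 * s) / (1734 * ((k : ℝ) + 2) ^ 3 * Real.log ((k : ℝ) + 2) ^ 2)) (k : ℕ) :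
    M k ≤ 36 * (D + s) / ((k + 1) * (k + 2)) := by
  have hW : 0 ≤ D + s := by linarith
  -- Here `36 = 4 (1 + 8)`. The bound on `V` is kept below `8 (D + s)` by partial sums of total at
  -- most `5 / 2 + 2`, which closes the induction.
  have step : ∀ k : ℕ, V k ≤ 8 * (D + s) → M k ≤ 36 * (D + s) / ((k + 1) * (k + 2)) := by
    intro k hk
    have := hM k
    rw [le_div_iff₀ (by positivity)]
    nlinarith
  suffices hVk : ∀ k : ℕ, V k ≤ (D + s) *
      (∑ j ∈ Finset.range k, 1 / (((j : ℝ) + 2) * Real.log ((j : ℝ) + 2) ^ 2)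
        + 2 * ∑ j ∈ Finset.range k, 1 / ((j : ℝ) + 2) ^ 2) by
    refine step k ((hVk k).trans ?_)
    rw [mul_comm (8 : ℝ)]
    refine mul_le_mul_of_nonneg_left ?_ hW
    have h1 := sum_inv_mul_log_sq_le k
    have h2 := sum_inv_add_two_sq_le k
    have : 0 ≤ 1 / ((k : ℝ) + 1) := by positivity
    linarith
  intro k
  induction k with
  | zero => simp [hV0]
  | succ k ih =>
    have hMk : M k ≤ 36 * (D + s) / ((k + 1) * (k + 2)) := by
      refine step k (ih.trans ?_)
      rw [mul_comm (8 : ℝ)]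
      refine mul_le_mul_of_nonneg_left ?_ hW
      have h1 := sum_inv_mul_log_sq_le k
      have h2 := sum_inv_add_two_sq_le k
      have : 0 ≤ 1 / ((k : ℝ) + 1) := by positivity
      linarith
    have hk : (0 : ℝ) ≤ k := k.cast_nonneg
    have hl : 0 < Real.log ((k : ℝ) + 2) := Real.log_pos (by linarith)
    have h18 : M k ≤ 18 * (D + s) := by
      refine hMk.trans ?_
      rw [div_le_iff₀ (by positivity)]
      nlinarith [mul_nonneg hW hk, mul_nonneg (mul_nonneg hW hk) hk]
    -- With `M k ≤ 18 (D + s)` the numerator of the error is at most `(3 · 18 + 24) (D + s) = 78 (D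
    -- + s)`, and `5 · 78 ≤ 1734`.
    have h1 : 5 * (((k : ℝ) + 1) * (k + 2)) * e k ≤
        (D + s) * (1 / (((k : ℝ) + 2) * Real.log ((k : ℝ) + 2) ^ 2)) := by
      have a1 : e k ≤
          (78 * (D + s)) / (1734 * ((k : ℝ) + 2) ^ 3 * Real.log ((k : ℝ) + 2) ^ 2) := by
        refine (he k).trans ?_
        gcongr
        linarith
      calc 5 * (((k : ℝ) + 1) * (k + 2)) * e k
          ≤ 5 * (((k : ℝ) + 2) * (k + 2)) *
            ((78 * (D + s)) / (1734 * ((k : ℝ) + 2) ^ 3 * Real.log ((k : ℝ) + 2) ^ 2)) := by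
            refine (mul_le_mul_of_nonneg_left a1 (by positivity)).trans ?_
            gcongr
            norm_num
        _ = (390 / 1734) *
            ((D + s) * (1 / (((k : ℝ) + 2) * Real.log ((k : ℝ) + 2) ^ 2))) := by
            field_simp; ring
        _ ≤ _ := mul_le_of_le_one_left (by positivity) (by norm_num)
    have h2 : ((k : ℝ) + 1) / (k + 2) / 18 * M k ≤ (D + s) * (2 * (1 / ((k : ℝ) + 2) ^ 2)) := by
      refine (mul_le_mul_of_nonneg_left hMk (by positivity)).trans_eq ?_
      field_simp; ring
    rw [Finset.sum_range_succ, Finset.sum_range_succ]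
    have := hV k
    linarith

end Numeric

/-! ### Square-integrable random vectors. -/

section SquareIntegrable

variable {Ω E : Type*} [MeasurableSpace Ω] {Pr : Measure Ω}
  [NormedAddCommGroup E]

theorem memLp_two_integrable_inner [InnerProductSpace ℝ E] {f g : Ω → E} (hf : MemLp f 2 Pr) (hg : MemLp g 2 Pr) :
    Integrable (fun ω => (inner ℝ (f ω) (g ω) : ℝ)) Pr := by
  refine (hf.norm.integrable_mul hg.norm).mono (hf.1.inner hg.1) (ae_of_all _ fun ω => ?_)
  have := norm_inner_le_norm (𝕜 := ℝ) (f ω) (g ω)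
  simpa using this

theorem memLp_two_integrable_norm_sq {f : Ω → E} (hf : MemLp f 2 Pr) :
    Integrable (fun ω => ‖f ω‖ ^ 2) Pr :=
  (memLp_two_iff_integrable_sq_norm hf.1).1 hf

theorem LipschitzWith.memLp_comp_of_isFiniteMeasure [IsFiniteMeasure Pr] {K : ℝ≥0} {g : E → E}
    (hg : LipschitzWith K g) {f : Ω → E} (hf : MemLp f 2 Pr) :
    MemLp (fun ω => g (f ω)) 2 Pr := by
  refine (((memLp_const ‖g 0‖).add (hf.norm.const_mul (K : ℝ)))).mono
    (hg.continuous.comp_aestronglyMeasurable hf.1) (ae_of_all _ fun ω => ?_)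
  have h1 := hg.norm_sub_le (f ω) 0
  rw [sub_zero] at h1
  have h2 : ‖g (f ω)‖ ≤ ‖g (f ω) - g 0‖ + ‖g 0‖ := by
    simpa using norm_add_le (g (f ω) - g 0) (g 0)
  refine h2.trans ?_
  simp only [Pi.add_apply]
  rw [Real.norm_of_nonneg (by positivity)]
  linarith

theorem sq_integral_le_integral_sq [IsProbabilityMeasure Pr] {f : Ω → ℝ} (hf : MemLp f 2 Pr) :
    (∫ ω, f ω ∂Pr) ^ 2 ≤ ∫ ω, f ω ^ 2 ∂Pr := by
  have := variance_nonneg f Pr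
  rw [variance_eq_sub hf] at this
  simpa using this

end SquareIntegrable

/-! ### Filtration of the seeds and independence of the next one. -/

section Seeds

variable {Ω S : Type*} [MeasurableSpace S]

/-- The σ-algebra generated by the seeds with index less than `n`. -/
@[reducible]
def seedAlgebra (ξ : ℕ → Ω → S) (n : ℕ) : MeasurableSpace Ω :=
  ⨆ i ∈ Set.Iio n, MeasurableSpace.comap (ξ i) inferInstance

theorem seedAlgebra_mono (ξ : ℕ → Ω → S) {m n : ℕ} (h : m ≤ n) :
    seedAlgebra ξ m ≤ seedAlgebra ξ n :=
  biSup_mono fun _ hi => lt_of_lt_of_le hi h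

theorem measurable_seed (ξ : ℕ → Ω → S) {m n : ℕ} (h : m < n) :
    Measurable[seedAlgebra ξ n] (ξ m) :=
  Measurable.of_comap_le
    (le_iSup₂_of_le (f := fun i (_ : i ∈ Set.Iio n) => MeasurableSpace.comap (ξ i) inferInstance)
      m h le_rfl)

variable [MeasurableSpace Ω]

theorem seedAlgebra_le {ξ : ℕ → Ω → S} (hξ : ∀ n, Measurable (ξ n)) (n : ℕ) :
    seedAlgebra ξ n ≤ ‹MeasurableSpace Ω› :=
  iSup₂_le fun i _ => (hξ i).comap_le

theorem indepFun_seed {β : Type*} [MeasurableSpace β] {Pr : Measure Ω} {ξ : ℕ → Ω → S}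
    (hξ : ∀ n, Measurable (ξ n)) (hind : iIndepFun ξ Pr) {n : ℕ} {X : Ω → β}
    (hX : Measurable[seedAlgebra ξ n] X) : IndepFun X (ξ n) Pr := by
  have h := indep_iSup_of_disjoint (fun i => (hξ i).comap_le) hind.iIndep
    (S := Set.Iio n) (T := {n}) (by simp)
  rw [IndepFun_iff_Indep]
  refine indep_of_indep_of_le_left (indep_of_indep_of_le_right h ?_) hX.comap_le
  exact le_iSup₂_of_le
    (f := fun i (_ : i ∈ ({n} : Set ℕ)) => MeasurableSpace.comap (ξ i) inferInstance)
      n rfl le_rfl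

/-- Stands in for conditioning on the past: the joint law is a product, so Fubini reduces a random
query point to a fixed one. -/
theorem map_prodMk_seed {β : Type*} [MeasurableSpace β] {Pr : Measure Ω} [IsProbabilityMeasure Pr]
    {P : Measure S} {ξ : ℕ → Ω → S}
    (hξ : ∀ n, Measurable (ξ n)) (hP : ∀ n, Pr.map (ξ n) = P) (hind : iIndepFun ξ Pr) {n : ℕ}
    {X : Ω → β} (hX : Measurable[seedAlgebra ξ n] X) :
    Pr.map (fun ω => (X ω, ξ n ω)) = (Pr.map X).prod P := by
  rw [← hP n]
  exact (indepFun_iff_map_prod_eq_prod_map_map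
    (hX.mono (seedAlgebra_le hξ n) le_rfl).aemeasurable (hξ n).aemeasurable).1
    (indepFun_seed hξ hind hX)

end Seeds

/-! ### Oracle noise at random query points. -/

section Oracle

variable {Ω S E : Type*} [MeasurableSpace Ω] [MeasurableSpace S] {Pr : Measure Ω}
  [IsProbabilityMeasure Pr] {P : Measure S}
  [NormedAddCommGroup E] [InnerProductSpace ℝ E] [FiniteDimensional ℝ E] [MeasurableSpace E]
  [BorelSpace E]
  {ξ : ℕ → Ω → S} {F : E → E} {Ft : E → S → E} {σ : ℝ}

/-- Stated with the Lebesgue integral in `ℝ≥0∞` because square integrability of the noise is deduced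
from it. -/
theorem IsStochasticOracle.lintegral_noise_le (hO : IsStochasticOracle P F Ft σ)
    (hF : Continuous F) (hξ : ∀ n, Measurable (ξ n)) (hP : ∀ n, Pr.map (ξ n) = P)
    (hind : iIndepFun ξ Pr) {n : ℕ} {X : Ω → E} (hX : Measurable[seedAlgebra ξ n] X) :
    ∫⁻ ω, ‖Ft (X ω) (ξ n ω) - F (X ω)‖ₑ ^ 2 ∂Pr ≤ ENNReal.ofReal (σ ^ 2) := by
  have hX' : Measurable X := hX.mono (seedAlgebra_le hξ n) le_rfl
  have : IsProbabilityMeasure P := hP n ▸ Measure.isProbabilityMeasure_map (hξ n).aemeasurable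
  have : IsProbabilityMeasure (Pr.map X) := Measure.isProbabilityMeasure_map hX'.aemeasurable
  have hg : Measurable fun p : E × S => ‖Ft p.1 p.2 - F p.1‖ₑ ^ 2 :=
    ((hO.measurable.sub (hF.measurable.comp measurable_fst)).enorm).pow_const 2
  have e : ∫⁻ ω, ‖Ft (X ω) (ξ n ω) - F (X ω)‖ₑ ^ 2 ∂Pr =
      ∫⁻ p, ‖Ft p.1 p.2 - F p.1‖ₑ ^ 2 ∂(Pr.map fun ω => (X ω, ξ n ω)) :=
    (lintegral_map hg (hX'.prodMk (hξ n))).symm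
  rw [e, map_prodMk_seed hξ hP hind hX, lintegral_prod _ hg.aemeasurable]
  calc ∫⁻ x, ∫⁻ s, ‖Ft x s - F x‖ₑ ^ 2 ∂P ∂(Pr.map X)
      ≤ ∫⁻ _, ENNReal.ofReal (σ ^ 2) ∂(Pr.map X) := lintegral_mono fun x => hO.variance_le x
    _ = _ := by simp

theorem IsStochasticOracle.memLp_noise (hO : IsStochasticOracle P F Ft σ)
    (hF : Continuous F) (hξ : ∀ n, Measurable (ξ n)) (hP : ∀ n, Pr.map (ξ n) = P)
    (hind : iIndepFun ξ Pr) {n : ℕ} {X : Ω → E} (hX : Measurable[seedAlgebra ξ n] X) :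
    MemLp (fun ω => Ft (X ω) (ξ n ω) - F (X ω)) 2 Pr := by
  have hX' : Measurable X := hX.mono (seedAlgebra_le hξ n) le_rfl
  have hm : Measurable fun ω => Ft (X ω) (ξ n ω) - F (X ω) :=
    (hO.measurable.comp (hX'.prodMk (hξ n))).sub (hF.measurable.comp hX')
  refine ⟨hm.aestronglyMeasurable, ?_⟩
  rw [eLpNorm_lt_top_iff_lintegral_rpow_enorm_lt_top (by norm_num) (by norm_num)]
  have := hO.lintegral_noise_le hF hξ hP hind hX
  simpa using this.trans_lt ENNReal.ofReal_lt_top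

theorem IsStochasticOracle.integral_noise_sq_le (hO : IsStochasticOracle P F Ft σ)
    (hF : Continuous F) (hξ : ∀ n, Measurable (ξ n)) (hP : ∀ n, Pr.map (ξ n) = P)
    (hind : iIndepFun ξ Pr) {n : ℕ} {X : Ω → E} (hX : Measurable[seedAlgebra ξ n] X) :
    ∫ ω, ‖Ft (X ω) (ξ n ω) - F (X ω)‖ ^ 2 ∂Pr ≤ σ ^ 2 := by
  have hm := (hO.memLp_noise hF hξ hP hind hX).1
  rw [integral_eq_lintegral_of_nonneg_ae (ae_of_all _ fun _ => by positivity)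
    (hm.norm.aemeasurable.pow_const 2).aestronglyMeasurable]
  refine ENNReal.toReal_le_of_le_ofReal (by positivity) ?_
  have := hO.lintegral_noise_le hF hξ hP hind hX
  simpa [ENNReal.ofReal_pow] using this

/-- The pair `(X, Y)` is jointly independent of the seed `n`; integrating over that seed first gives
zero for each fixed value of the pair. -/
theorem IsStochasticOracle.integral_inner_noise (hO : IsStochasticOracle P F Ft σ)
    (hF : Continuous F) (hξ : ∀ n, Measurable (ξ n)) (hP : ∀ n, Pr.map (ξ n) = P)
    (hind : iIndepFun ξ Pr) {n : ℕ} {X Y : Ω → E} (hX : Measurable[seedAlgebra ξ n] X)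
    (hY : Measurable[seedAlgebra ξ n] Y) (hY2 : MemLp Y 2 Pr) :
    ∫ ω, inner ℝ (Ft (X ω) (ξ n ω) - F (X ω)) (Y ω) ∂Pr = 0 := by
  have hXY := hX.prodMk hY
  have hXY' : Measurable fun ω => (X ω, Y ω) := hXY.mono (seedAlgebra_le hξ n) le_rfl
  have : IsProbabilityMeasure P := hP n ▸ Measure.isProbabilityMeasure_map (hξ n).aemeasurable
  have : IsProbabilityMeasure (Pr.map fun ω => (X ω, Y ω)) :=
    Measure.isProbabilityMeasure_map hXY'.aemeasurable
  let g : (E × E) × S → ℝ := fun p => inner ℝ (Ft p.1.1 p.2 - F p.1.1) p.1.2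
  have hg : Measurable g := by
    have h1 : Measurable fun p : (E × E) × S => Ft p.1.1 p.2 :=
      hO.measurable.comp ((measurable_fst.comp measurable_fst).prodMk measurable_snd)
    have h2 : Measurable fun p : (E × E) × S => F p.1.1 :=
      hF.measurable.comp (measurable_fst.comp measurable_fst)
    exact (h1.sub h2).inner (measurable_snd.comp measurable_fst)
  have hpair : Measurable fun ω => ((X ω, Y ω), ξ n ω) := hXY'.prodMk (hξ n)
  have hint : Integrable g (Pr.map fun ω => ((X ω, Y ω), ξ n ω)) :=
    (integrable_map_measure hg.aestronglyMeasurable hpair.aemeasurable).2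
      (memLp_two_integrable_inner (hO.memLp_noise hF hξ hP hind hX) hY2)
  have e : ∫ ω, inner ℝ (Ft (X ω) (ξ n ω) - F (X ω)) (Y ω) ∂Pr =
      ∫ p, g p ∂(Pr.map fun ω => ((X ω, Y ω), ξ n ω)) :=
    (integral_map hpair.aemeasurable hg.aestronglyMeasurable).symm
  rw [map_prodMk_seed hξ hP hind hXY] at hint e
  rw [e, integral_prod _ hint]
  refine integral_eq_zero_of_ae (ae_of_all _ fun p => ?_)
  have hc : ∫ s, g (p, s) ∂P = ∫ s, inner ℝ p.2 (Ft p.1 s - F p.1) ∂P :=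
    integral_congr_ae (ae_of_all _ fun s => real_inner_comm _ _)
  have h0 : ∫ s, (Ft p.1 s - F p.1) ∂P = 0 := by
    rw [integral_sub (hO.integrable p.1) (integrable_const _), hO.unbiased]
    simp
  simp only [Pi.zero_apply]
  have hi : Integrable (fun s => Ft p.1 s - F p.1) P :=
    (hO.integrable p.1).sub (integrable_const _)
  rw [hc, integral_inner hi, h0, inner_zero_right]

end Oracle

/-! ### One FBF step in expectation. -/

section ForwardBackwardForward

variable {Ω S E : Type*} [MeasurableSpace Ω] [MeasurableSpace S] {Pr : Measure Ω}
  [IsProbabilityMeasure Pr] {P : Measure S}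
  [NormedAddCommGroup E] [InnerProductSpace ℝ E] [FiniteDimensional ℝ E] [MeasurableSpace E]
  [BorelSpace E]
  {ξ : ℕ → Ω → S} {F : E → E} {G : E → Set E} {Ft : E → S → E} {L : ℝ≥0} {η σ : ℝ}

/-- One step of stochastic forward-backward-forward for `0 ∈ y + η F y - x + η G y` at random
points that depend on the seeds used so far. -/
theorem fbf_step_expectation (hF : LipschitzWith L F) (hG : IsMaximallyMonotone G)
    (hO : IsStochasticOracle P F Ft σ) (hξ : ∀ n, Measurable (ξ n))
    (hP : ∀ n, Pr.map (ξ n) = P) (hind : iIndepFun ξ Pr) (hη : 0 < η) (hηL : η * L < 1)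
    {n : ℕ} {z x zs : Ω → E} (hz : Measurable[seedAlgebra ξ n] z) (hz2 : MemLp z 2 Pr)
    (hx : Measurable[seedAlgebra ξ n] x) (hx2 : MemLp x 2 Pr)
    (hzs : Measurable[seedAlgebra ξ n] zs) (hzs2 : MemLp zs 2 Pr)
    (hres : ∀ ω, IsResolventValue (scaleOperator η (sumOperator F G)) (x ω) (zs ω))
    {τ : ℝ} (hτ : 0 < τ) (hτL : 3 * τ * (1 + η * L) ≤ 1) {b h p : Ω → E}
    (hb : b = fun ω => z ω + η • Ft (z ω) (ξ n ω) - x ω)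
    (hh : h = fun ω =>
      operatorResolvent (scaleOperator τ (scaleOperator η G)) (z ω - τ • b ω))
    (hp : p = fun ω => h ω + τ • b ω - τ • (h ω + η • Ft (h ω) (ξ (n + 1) ω) - x ω)) :
    Measurable[seedAlgebra ξ (n + 2)] p ∧ MemLp p 2 Pr ∧
      ∫ ω, ‖p ω - zs ω‖ ^ 2 ∂Pr ≤
        (1 - τ * (1 - η * L)) * ∫ ω, ‖z ω - zs ω‖ ^ 2 ∂Pr + 6 * τ ^ 2 * (η ^ 2 * σ ^ 2) := by
  have hFc := hF.continuous
  have hle1 := seedAlgebra_mono ξ (Nat.le_succ n)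
  have hle2 := seedAlgebra_mono ξ (Nat.le_succ (n + 1))
  have hlip : LipschitzWith 1 (operatorResolvent (scaleOperator τ (scaleOperator η G))) := by
    rw [scaleOperator_scaleOperator]
    exact hG.lipschitzWith_operatorResolvent (mul_pos hτ hη)
  set ν : Ω → E := fun ω => Ft (z ω) (ξ n ω) - F (z ω) with hν
  set ν' : Ω → E := fun ω => Ft (h ω) (ξ (n + 1) ω) - F (h ω) with hν'
  have hFt : ∀ {m : MeasurableSpace Ω} {f : Ω → E} {s : Ω → S}, Measurable[m] f →
      Measurable[m] s → Measurable[m] fun ω => Ft (f ω) (s ω) := fun hf hs =>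
    hO.measurable.comp (hf.prodMk hs)
  have hz1 := hz.mono hle1 le_rfl
  have hx1 := hx.mono hle1 le_rfl
  have hbm : Measurable[seedAlgebra ξ (n + 1)] b := by
    rw [hb]
    exact (hz1.add ((hFt hz1 (measurable_seed ξ (Nat.lt_succ_self n))).const_smul η)).sub hx1
  have hhm : Measurable[seedAlgebra ξ (n + 1)] h := by
    rw [hh]
    exact hlip.continuous.measurable.comp (hz1.sub (hbm.const_smul τ))
  have hpm : Measurable[seedAlgebra ξ (n + 2)] p := by
    rw [hp]
    have h1 := hhm.mono hle2 le_rfl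
    have h2 := hbm.mono hle2 le_rfl
    have h3 := hx1.mono hle2 le_rfl
    exact (h1.add (h2.const_smul τ)).sub ((((h1.add
      ((hFt h1 (measurable_seed ξ (Nat.lt_succ_self (n + 1)))).const_smul η))).sub h3).const_smul τ)
  have hν2 : MemLp ν 2 Pr := hO.memLp_noise hFc hξ hP hind hz
  have hν2' : MemLp ν' 2 Pr := hO.memLp_noise hFc hξ hP hind hhm
  have hb' : b = fun ω => z ω + η • (ν ω + F (z ω)) - x ω := by
    rw [hb]; funext ω; simp [hν]
  have hb2 : MemLp b 2 Pr := by
    rw [hb']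
    exact (hz2.add ((hν2.add (hF.memLp_comp_of_isFiniteMeasure hz2)).const_smul η)).sub hx2
  have hh2 : MemLp h 2 Pr := by
    rw [hh]
    exact hlip.memLp_comp_of_isFiniteMeasure (hz2.sub (hb2.const_smul τ))
  have hp' : p = fun ω => h ω + τ • b ω - τ • (h ω + η • (ν' ω + F (h ω)) - x ω) := by
    rw [hp]; funext ω; simp [hν']
  have hp2 : MemLp p 2 Pr := by
    rw [hp']
    exact (hh2.add (hb2.const_smul τ)).sub ((((hh2.add
      ((hν2'.add (hF.memLp_comp_of_isFiniteMeasure hh2)).const_smul η))).sub hx2).const_smul τ)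
  refine ⟨hpm, hp2, ?_⟩
  have hL0 : 0 ≤ η * L := by positivity
  have hpt : ∀ ω, ‖p ω - zs ω‖ ^ 2 ≤ (1 - τ * (1 - η * L)) * ‖z ω - zs ω‖ ^ 2
      - 2 * τ * η * inner ℝ (ν' ω) (h ω - zs ω)
      + 3 * τ ^ 2 * η ^ 2 * (‖ν ω‖ ^ 2 + ‖ν' ω‖ ^ 2) := by
    intro ω
    have hFn : ∀ a c : E, ‖η • (F a - F c)‖ ≤ η * L * ‖a - c‖ := by
      intro a c
      rw [norm_smul, Real.norm_of_nonneg hη.le, mul_assoc]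
      exact mul_le_mul_of_nonneg_left (hF.norm_sub_le a c) hη.le
    have hmain := fbf_step_norm_sq_le (z := z ω) (h := h ω) (zs := zs ω)
      (Bz := z ω + η • F (z ω) - x ω) (Bh := h ω + η • F (h ω) - x ω)
      (Bs := zs ω + η • F (zs ω) - x ω) (ν := η • ν ω) (ν' := η • ν' ω)
      (τ := τ) (μ := 1 - η * L) (LB := 1 + η * L) hτ (by linarith) (by linarith) hτL ?_ ?_ ?_
    · rw [norm_smul, norm_smul, real_inner_smul_left, mul_pow, mul_pow, Real.norm_eq_abs,
        sq_abs] at hmain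
      have e : p ω - zs ω = h ω + τ • (z ω + η • F (z ω) - x ω + η • ν ω)
          - τ • (h ω + η • F (h ω) - x ω + η • ν' ω) - zs ω := by
        rw [hp', hb']; module
      rw [e]
      linarith
    -- Monotonicity of `τ η G` between `h`, a value of its resolvent, and `zs`, where `τ η g` equals
    -- `-τ • Bs`.
    · obtain ⟨g, hg, e⟩ := isResolventValue_scale_sumOperator_iff.1 (hres ω)
      have hhres : IsResolventValue (scaleOperator τ (scaleOperator η G)) (z ω - τ • b ω) (h ω) := by
        rw [hh, scaleOperator_scaleOperator]
        exact isResolventValue_operatorResolvent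
          (hG.exists_isResolventValue (mul_pos hτ hη) _)
      have hmono := (hG.1.scale hη.le).scale hτ.le (h ω) (zs ω) _ hhres (τ • η • g)
        ⟨_, ⟨g, hg, rfl⟩, rfl⟩
      convert hmono using 2
      rw [← e, hb']
      module
    · have e : h ω + η • F (h ω) - x ω - (zs ω + η • F (zs ω) - x ω) =
          (h ω - zs ω) + η • (F (h ω) - F (zs ω)) := by module
      rw [e, inner_add_left, real_inner_self_eq_norm_sq]
      have h1 := neg_le_of_abs_le (abs_real_inner_le_norm (η • (F (h ω) - F (zs ω))) (h ω - zs ω))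
      have h2 := mul_le_mul_of_nonneg_right (hFn (h ω) (zs ω)) (norm_nonneg (h ω - zs ω))
      nlinarith
    · have e : z ω + η • F (z ω) - x ω - (h ω + η • F (h ω) - x ω) =
          (z ω - h ω) + η • (F (z ω) - F (h ω)) := by module
      rw [e]
      refine (norm_add_le _ _).trans ?_
      have := hFn (z ω) (h ω)
      linarith
  have i1 := memLp_two_integrable_norm_sq (hp2.sub hzs2)
  have i2 := memLp_two_integrable_norm_sq (hz2.sub hzs2)
  have i3 := memLp_two_integrable_inner hν2' (hh2.sub hzs2)
  have i4 := memLp_two_integrable_norm_sq hν2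
  have i5 := memLp_two_integrable_norm_sq hν2'
  have j1 : Integrable (fun ω => (1 - τ * (1 - η * L)) * ‖z ω - zs ω‖ ^ 2) Pr := i2.const_mul _
  have j2 : Integrable (fun ω => 2 * τ * η * inner ℝ (ν' ω) (h ω - zs ω)) Pr := i3.const_mul _
  have j3 : Integrable (fun ω => ‖ν ω‖ ^ 2 + ‖ν' ω‖ ^ 2) Pr := i4.add i5
  have j4 : Integrable (fun ω => 3 * τ ^ 2 * η ^ 2 * (‖ν ω‖ ^ 2 + ‖ν' ω‖ ^ 2)) Pr := j3.const_mul _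
  have j5 : Integrable (fun ω => (1 - τ * (1 - η * L)) * ‖z ω - zs ω‖ ^ 2
      - 2 * τ * η * inner ℝ (ν' ω) (h ω - zs ω)) Pr := j1.sub j2
  have hI := integral_mono i1 (j5.add j4) hpt
  -- The half point `h` uses seeds up to index `n`, and `ν'` uses seed `n + 1`.
  have hinner : ∫ ω, inner ℝ (ν' ω) (h ω - zs ω) ∂Pr = 0 :=
    hO.integral_inner_noise hFc hξ hP hind hhm (hhm.sub (hzs.mono hle1 le_rfl)) (hh2.sub hzs2)
  have s1 : ∫ ω, ‖ν ω‖ ^ 2 ∂Pr ≤ σ ^ 2 := hO.integral_noise_sq_le hFc hξ hP hind hz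
  have s2 : ∫ ω, ‖ν' ω‖ ^ 2 ∂Pr ≤ σ ^ 2 := hO.integral_noise_sq_le hFc hξ hP hind hhm
  have hsplit := integral_add j5 j4
  simp only [Pi.add_apply] at hI
  rw [hsplit, integral_sub j1 j2, integral_const_mul, integral_const_mul, integral_const_mul,
    integral_add i4 i5, hinner] at hI
  have s3 := mul_le_mul_of_nonneg_left (add_le_add s1 s2)
    (by positivity : 0 ≤ 3 * τ ^ 2 * η ^ 2)
  simp only [Pi.sub_apply] at hI
  linarith

end ForwardBackwardForward

/-! ### Oracle counters. -/

section Counters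

variable {E S : Type*} [AddCommGroup E] [Module ℝ E]

theorem stochasticFBF_counters (A : E → Set E) (BtIn : E → S → E) (LB μ : ℝ) (seeds : ℕ → S)
    (z₀ : OracleState E) (t : ℕ) :
    (stochasticFBF A BtIn LB μ seeds z₀ t).evals = z₀.evals + 2 * t ∧
      (stochasticFBF A BtIn LB μ seeds z₀ t).resolvents = z₀.resolvents + t := by
  induction t with
  | zero => exact ⟨rfl, rfl⟩
  | succ t ih =>
    simp only [stochasticFBF, fbfStep, ih]
    constructor <;> ring

/-- Besides the complexity count, this shows that the index of the next seed is deterministic, which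
the filtration argument needs. -/
theorem stochasticHalpern_counters (G : E → Set E) (Ft : E → S → E) (η L ρ : ℝ) (x₀ : E)
    (seeds : ℕ → S) (k : ℕ) :
    (stochasticHalpern G Ft η L ρ x₀ seeds k).evals =
        2 * ∑ j ∈ Finset.range k, innerIterations η L j ∧
      (stochasticHalpern G Ft η L ρ x₀ seeds k).resolvents =
        ∑ j ∈ Finset.range k, innerIterations η L j := by
  induction k with
  | zero => exact ⟨rfl, rfl⟩
  | succ k ih =>
    simp only [stochasticHalpern, stochasticFBF_counters, ih, Finset.sum_range_succ]
    exact ⟨by ring, trivial⟩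

end Counters

theorem innerIterations_pos {η L : ℝ} (h : η * L < 1) (k : ℕ) : 1 ≤ innerIterations η L k := by
  have hk : (0 : ℝ) ≤ k := k.cast_nonneg
  have hl : 0 < Real.log ((k : ℝ) + 2) := Real.log_pos (by linarith)
  have hμ : 0 < 1 - η * L := by linarith
  exact Nat.one_le_iff_ne_zero.2 (Nat.ceil_pos.2 (by positivity)).ne'

/-! ### Expected error of the inner loop and of the outer loop. -/

section Expectations

variable {Ω S E : Type*} [MeasurableSpace Ω] [MeasurableSpace S] {Pr : Measure Ω}
  [IsProbabilityMeasure Pr] {P : Measure S}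
  [NormedAddCommGroup E] [InnerProductSpace ℝ E] [FiniteDimensional ℝ E] [MeasurableSpace E]
  [BorelSpace E]
  {ξ : ℕ → Ω → S} {F : E → E} {G : E → Set E} {Ft : E → S → E} {L : ℝ≥0} {η ρ σ : ℝ}

/-- Stochastic forward-backward-forward approximates the resolvent of `η (F + G)`. -/
theorem stochasticFBF_expectation (hF : LipschitzWith L F) (hG : IsMaximallyMonotone G)
    (hO : IsStochasticOracle P F Ft σ) (hξ : ∀ n, Measurable (ξ n))
    (hP : ∀ n, Pr.map (ξ n) = P) (hind : iIndepFun ξ Pr) (hη : 0 < η) (hηL : η * L < 1)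
    {n : ℕ} {st : Ω → OracleState E} (hn : ∀ ω, (st ω).evals = n) {zs : Ω → E}
    (hx : Measurable[seedAlgebra ξ n] fun ω => (st ω).point)
    (hx2 : MemLp (fun ω => (st ω).point) 2 Pr)
    (hzs : Measurable[seedAlgebra ξ n] zs) (hzs2 : MemLp zs 2 Pr)
    (hres : ∀ ω, IsResolventValue (scaleOperator η (sumOperator F G)) (st ω).point (zs ω))
    {N : ℕ} (hN : 1 ≤ N) {Z : Ω → E}
    (hZ : Z = fun ω => (stochasticFBF (scaleOperator η G) (fun z s => z + η • Ft z s) (1 + η * L)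
      (1 - η * L) (fun n => ξ n ω) (st ω) N).point) :
    Measurable[seedAlgebra ξ (n + 2 * N)] Z ∧ MemLp Z 2 Pr ∧
      ∫ ω, ‖Z ω - zs ω‖ ^ 2 ∂Pr ≤
        (3 * ∫ ω, ‖(st ω).point - zs ω‖ ^ 2 ∂Pr + 24 * (η ^ 2 * σ ^ 2)) /
          ((1 - η * L) ^ 2 * N) := by
  let z : ℕ → Ω → E := fun t ω => (stochasticFBF (scaleOperator η G) (fun z s => z + η • Ft z s)
    (1 + η * L) (1 - η * L) (fun n => ξ n ω) (st ω) t).point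
  have hL0 : 0 ≤ η * L := by positivity
  have hstep : ∀ t, Measurable[seedAlgebra ξ (n + 2 * t)] (z t) → MemLp (z t) 2 Pr →
      Measurable[seedAlgebra ξ (n + 2 * t + 2)] (z (t + 1)) ∧ MemLp (z (t + 1)) 2 Pr ∧
        ∫ ω, ‖z (t + 1) ω - zs ω‖ ^ 2 ∂Pr ≤
        (1 - 2 / (((t : ℝ) + 1) * (1 - η * L) + 6 * (1 + η * L)) * (1 - η * L)) *
          ∫ ω, ‖z t ω - zs ω‖ ^ 2 ∂Pr +
        6 * (2 / (((t : ℝ) + 1) * (1 - η * L) + 6 * (1 + η * L))) ^ 2 * (η ^ 2 * σ ^ 2) := by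
    intro t hzt hzt2
    have hle : seedAlgebra ξ n ≤ seedAlgebra ξ (n + 2 * t) := seedAlgebra_mono ξ (by omega)
    have ht : (0 : ℝ) ≤ ((t : ℝ) + 1) * (1 - η * L) :=
      mul_nonneg (by positivity) (by linarith)
    refine fbf_step_expectation hF hG hO hξ hP hind hη hηL hzt hzt2 (hx.mono hle le_rfl) hx2
      (hzs.mono hle le_rfl) hzs2 hres
      (τ := 2 / (((t : ℝ) + 1) * (1 - η * L) + 6 * (1 + η * L))) (by positivity) ?_ rfl rfl ?_
    -- The summand `6 (1 + η L)` in the step-size denominator is what ensures `3 τ (1 + η L) ≤ 1`.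
    · rw [show 3 * (2 / (((t : ℝ) + 1) * (1 - η * L) + 6 * (1 + η * L))) * (1 + η * L) =
        6 * (1 + η * L) / (((t : ℝ) + 1) * (1 - η * L) + 6 * (1 + η * L)) by ring]
      exact (div_le_one (by positivity)).2 (by linarith)
    · funext ω
      have he : (stochasticFBF (scaleOperator η G) (fun z s => z + η • Ft z s)
          (1 + η * L) (1 - η * L) (fun n => ξ n ω) (st ω) t).evals = n + 2 * t := by
        rw [(stochasticFBF_counters _ _ _ _ _ _ _).1, hn]
      simp only [z, stochasticFBF, fbfStep, he]
  have hz : ∀ t, Measurable[seedAlgebra ξ (n + 2 * t)] (z t) ∧ MemLp (z t) 2 Pr := by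
    intro t
    induction t with
    | zero => exact ⟨hx, hx2⟩
    | succ t ih => exact ⟨(hstep t ih.1 ih.2).1, (hstep t ih.1 ih.2).2.1⟩
  have hrec := fbf_recursion_le (d := fun t => ∫ ω, ‖z t ω - zs ω‖ ^ 2 ∂Pr)
    (μ := 1 - η * L) (LB := 1 + η * L) (s := η ^ 2 * σ ^ 2) (by linarith) (by ring) (by linarith)
    (by positivity) (integral_nonneg fun _ => by positivity)
    (fun t => (hstep t (hz t).1 (hz t).2).2.2) hN
  rw [hZ]
  exact ⟨(hz N).1, (hz N).2, hrec⟩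

/-- The rate of stochastic Halpern iteration. -/
theorem stochasticHalpern_rate {x₀ xstar : E} (hF : LipschitzWith L F)
    (hG : IsMaximallyMonotone G) (hstar : 0 ∈ sumOperator F G xstar)
    (hFG : IsCohypomonotone ρ (sumOperator F G))
    (hO : IsStochasticOracle P F Ft σ) (hξ : ∀ n, Measurable (ξ n))
    (hP : ∀ n, Pr.map (ξ n) = P) (hind : iIndepFun ξ Pr) (hρ : 0 ≤ ρ) (hηL : η * L < 1)
    (hρη : ρ < η) {J : E → E} (hJ : J = operatorResolvent (scaleOperator η (sumOperator F G)))
    {X : ℕ → Ω → E}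
    (hX : X = fun k ω => (stochasticHalpern G Ft η L ρ x₀ (fun n => ξ n ω) k).point) (k : ℕ) :
    MemLp (fun ω => X k ω - J (X k ω)) 2 Pr ∧
      ∫ ω, ‖X k ω - J (X k ω)‖ ^ 2 ∂Pr ≤
        η ^ 2 / (η - ρ) ^ 2 * (36 * (‖x₀ - xstar‖ ^ 2 + η ^ 2 * σ ^ 2) / ((k + 1) * (k + 2))) := by
  have hη : 0 < η := hρ.trans_lt hρη
  set α : ℝ := 1 - ρ / η with hα
  have hα0 : 0 < α := by rw [hα, sub_pos, div_lt_one hη]; exact hρη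
  have hα1 : α ≤ 1 := by have : 0 ≤ ρ / η := by positivity
                         linarith
  have hres : ∀ x, IsResolventValue (scaleOperator η (sumOperator F G)) x (J x) := fun x => hJ ▸
    isResolventValue_operatorResolvent
      (hG.existsUnique_isResolventValue_sumOperator hF hη hηL x).exists
  have hJstar : J xstar = xstar := hJ ▸ existsUnique_operatorResolvent_eq
    (hG.existsUnique_isResolventValue_sumOperator hF hη hηL xstar) ⟨0, hstar, by simp⟩
  let R : E → E := fun x => α • (x - J x)
  have hcoc : ∀ x y, ‖R x - R y‖ ^ 2 ≤ inner ℝ (R x - R y) (x - y) := by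
    intro x y
    have h := mul_le_mul_of_nonneg_left
      (hFG.cocoercive_sub_resolvent hη (hres x) (hres y)) hα0.le
    have e : R x - R y = α • ((x - J x) - (y - J y)) := (smul_sub _ _ _).symm
    rw [e, norm_smul, Real.norm_of_nonneg hα0.le, real_inner_smul_left, mul_pow]
    refine le_trans (le_of_eq ?_) h
    rw [← hα]; ring
  have hRstar : R xstar = 0 := by simp [R, hJstar]
  have hRlip : LipschitzWith 1 R := by
    refine LipschitzWith.of_dist_le_mul fun x y => ?_
    rw [NNReal.coe_one, one_mul, dist_eq_norm, dist_eq_norm]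
    have h := (hcoc x y).trans (real_inner_le_norm _ _)
    by_contra! hlt
    nlinarith [norm_nonneg (x - y)]
  -- `J` is defined by choice; its measurability and its action on square-integrable vectors are
  -- read off from the Lipschitz map `R`.
  have hJR : ∀ x, J x = x - α⁻¹ • R x := by
    intro x
    simp only [R, smul_smul, inv_mul_cancel₀ hα0.ne', one_smul, sub_sub_cancel]
  have hJm : Measurable J := by
    have : J = fun x => x - α⁻¹ • R x := funext hJR
    rw [this]
    exact (continuous_id.sub (hRlip.continuous.const_smul _)).measurable
  have hJ2 : ∀ {f : Ω → E}, MemLp f 2 Pr → MemLp (fun ω => J (f ω)) 2 Pr := by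
    intro f hf
    simp only [hJR]
    exact hf.sub ((hRlip.memLp_comp_of_isFiniteMeasure hf).const_smul _)
  let T : ℕ → ℕ := fun k => 2 * ∑ j ∈ Finset.range k, innerIterations η L j
  let Z : ℕ → Ω → E := fun k ω =>
    (stochasticFBF (scaleOperator η G) (fun z s => z + η • Ft z s) (1 + η * L) (1 - η * L)
      (fun n => ξ n ω) (stochasticHalpern G Ft η L ρ x₀ (fun n => ξ n ω) k)
      (innerIterations η L k)).point
  have hXsucc : ∀ k, X (k + 1) = fun ω => (1 / ((k : ℝ) + 2)) • x₀ +
      (1 - 1 / ((k : ℝ) + 2)) • ((1 - α) • X k ω + α • Z k ω) := fun k => by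
    rw [hX]; rfl
  have hfbf : ∀ k, Measurable[seedAlgebra ξ (T k)] (X k) → MemLp (X k) 2 Pr →
      Measurable[seedAlgebra ξ (T k + 2 * innerIterations η L k)] (Z k) ∧ MemLp (Z k) 2 Pr ∧
      ∫ ω, ‖Z k ω - J (X k ω)‖ ^ 2 ∂Pr ≤
        (3 * ∫ ω, ‖X k ω - J (X k ω)‖ ^ 2 ∂Pr + 24 * (η ^ 2 * σ ^ 2)) /
          ((1 - η * L) ^ 2 * innerIterations η L k) := by
    intro k hm h2
    subst hX
    exact stochasticFBF_expectation hF hG hO hξ hP hind hη hηL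
      (st := fun ω => stochasticHalpern G Ft η L ρ x₀ (fun n => ξ n ω) k)
      (fun ω => (stochasticHalpern_counters G Ft η L ρ x₀ _ k).1) hm h2
      (hJm.comp hm) (hJ2 h2) (fun ω => hres _) (innerIterations_pos hηL k) rfl
  have hXmem : ∀ k, Measurable[seedAlgebra ξ (T k)] (X k) ∧ MemLp (X k) 2 Pr := by
    intro k
    induction k with
    | zero =>
      have : X 0 = fun _ => x₀ := by rw [hX]; rfl
      rw [this]
      exact ⟨measurable_const, memLp_const _⟩
    | succ k ih =>
      obtain ⟨h1, h2, -⟩ := hfbf k ih.1 ih.2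
      have hT : T (k + 1) = T k + 2 * innerIterations η L k := by
        simp only [T, Finset.sum_range_succ, mul_add]
      rw [hXsucc, hT]
      have hm := ih.1.mono (seedAlgebra_mono ξ (Nat.le_add_right (T k) (2 * innerIterations η L k)))
        le_rfl
      have m1 : MemLp (fun _ : Ω => (1 / ((k : ℝ) + 2)) • x₀) 2 Pr := memLp_const _
      have m2 : MemLp (fun ω => (1 - α) • X k ω + α • Z k ω) 2 Pr :=
        (ih.2.const_smul (1 - α)).add (h2.const_smul α)
      exact ⟨measurable_const.add
          (((hm.const_smul (1 - α)).add (h1.const_smul α)).const_smul _),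
        m1.add (m2.const_smul (1 - 1 / ((k : ℝ) + 2)))⟩
  have hs2 : ∀ k, MemLp (fun ω => R (X k ω)) 2 Pr := fun k =>
    hRlip.memLp_comp_of_isFiniteMeasure (hXmem k).2
  have he2 : ∀ k, MemLp (fun ω => α • (Z k ω - J (X k ω))) 2 Pr := fun k =>
    ((hfbf k (hXmem k).1 (hXmem k).2).2.1.sub (hJ2 (hXmem k).2)).const_smul α
  -- The potential with `n = k + 1`, left unsimplified to match the pathwise lemmas.
  let pot : ℕ → Ω → ℝ := fun k ω => ((k : ℝ) + 1 - 1) * (k + 1) / 2 * ‖R (X k ω)‖ ^ 2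
    + ((k : ℝ) + 1) * inner ℝ (R (X k ω)) (X k ω - x₀)
  have ipot : ∀ k, Integrable (pot k) Pr := fun k =>
    ((memLp_two_integrable_norm_sq (hs2 k)).const_mul _).add
      ((memLp_two_integrable_inner (hs2 k) ((hXmem k).2.sub (memLp_const x₀))).const_mul _)
  have hrate := halpern_recursion_le
    (M := fun k => ∫ ω, ‖R (X k ω)‖ ^ 2 ∂Pr) (V := fun k => ∫ ω, pot k ω ∂Pr)
    (e := fun k => ∫ ω, ‖α • (Z k ω - J (X k ω))‖ ^ 2 ∂Pr)
    (D := ‖x₀ - xstar‖ ^ 2) (s := η ^ 2 * σ ^ 2) (by positivity) (by positivity) ?_ ?_ ?_ ?_ k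
  · have hscale : ∀ ω, ‖R (X k ω)‖ ^ 2 = α ^ 2 * ‖X k ω - J (X k ω)‖ ^ 2 := by
      intro ω
      rw [norm_smul, mul_pow, Real.norm_eq_abs, sq_abs]
    refine ⟨(hXmem k).2.sub (hJ2 (hXmem k).2), ?_⟩
    simp only [hscale] at hrate
    rw [integral_const_mul] at hrate
    have hαη : η ^ 2 / (η - ρ) ^ 2 = (α ^ 2)⁻¹ := by
      rw [hα, one_sub_div hη.ne', div_pow, inv_div]
    rw [hαη, inv_mul_eq_div, le_div_iff₀ (by positivity), mul_comm]
    exact hrate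
  · have : X 0 = fun _ => x₀ := by rw [hX]; rfl
    simp [pot, this]
  · intro k
    have hpt : ∀ ω, pot (k + 1) ω ≤ pot k ω + 5 * (((k : ℝ) + 1) * (k + 2)) *
        ‖α • (Z k ω - J (X k ω))‖ ^ 2 + (k + 1) / (k + 2) / 18 * ‖R (X k ω)‖ ^ 2 := by
      intro ω
      have h := halpern_potential_step (s := R (X k ω)) (s' := R (X (k + 1) ω))
        (a := X k ω - x₀) (a' := X (k + 1) ω - x₀) (e := α • (Z k ω - J (X k ω)))
        (n := (k : ℝ) + 1) (by positivity) ?_ ?_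
      · simp only [pot]
        push_cast
        rw [show (k : ℝ) + 2 = k + 1 + 1 by ring]
        refine le_trans (le_of_eq ?_) h
        ring
      · have hk2 : (k : ℝ) + 2 ≠ 0 := by positivity
        have e1 : (1 : ℝ) - 1 / ((k : ℝ) + 2) = (k + 1) / (k + 1 + 1) := by
          rw [show (k : ℝ) + 1 + 1 = k + 2 by ring]; field_simp; ring
        have e2 : (1 : ℝ) / ((k : ℝ) + 2) = 1 - (k + 1) / (k + 1 + 1) := by rw [← e1]; ring
        rw [hXsucc]
        simp only [R]
        rw [e1, e2]
        module
      · rw [sub_sub_sub_cancel_right]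
        exact hcoc _ _
    have j1 := (memLp_two_integrable_norm_sq (he2 k)).const_mul (5 * (((k : ℝ) + 1) * (k + 2)))
    have j2 := (memLp_two_integrable_norm_sq (hs2 k)).const_mul (((k : ℝ) + 1) / (k + 2) / 18)
    have j3 := (ipot k).add j1
    refine (integral_mono (ipot (k + 1)) (j3.add j2) hpt).trans_eq ?_
    rw [integral_add' j3 j2, integral_add' (ipot k) j1, integral_const_mul, integral_const_mul]
  · intro k
    have hpt : ∀ ω, ((k : ℝ) + 1) * (k + 2) / 4 * ‖R (X k ω)‖ ^ 2 ≤
        ‖x₀ - xstar‖ ^ 2 + pot k ω := by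
      intro ω
      have h := residual_le_halpern_potential (s := R (X k ω)) (a := X k ω - x₀)
        (c := x₀ - xstar) (n := (k : ℝ) + 1) (by positivity) (by
          have := hcoc (X k ω) xstar
          rwa [hRstar, sub_zero, ← sub_add_sub_cancel (X k ω) x₀ xstar] at this)
      rwa [show (k : ℝ) + 1 + 1 = k + 2 by ring] at h
    have j1 := (memLp_two_integrable_norm_sq (hs2 k)).const_mul (((k : ℝ) + 1) * (k + 2) / 4)
    have j2 : Integrable (fun _ : Ω => ‖x₀ - xstar‖ ^ 2) Pr := integrable_const _
    have h := integral_mono j1 (j2.add (ipot k)) hpt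
    rw [integral_const_mul, integral_add' j2 (ipot k)] at h
    simpa using h
  · intro k
    have hscale : ∀ v : E, ‖α • v‖ ^ 2 = α ^ 2 * ‖v‖ ^ 2 := by
      intro v
      rw [norm_smul, mul_pow, Real.norm_eq_abs, sq_abs]
    simp only [R, hscale]
    rw [integral_const_mul, integral_const_mul]
    have h1 := mul_le_mul_of_nonneg_left (hfbf k (hXmem k).1 (hXmem k).2).2.2 (sq_nonneg α)
    refine h1.trans ?_
    have hk : (0 : ℝ) ≤ k := k.cast_nonneg
    have hl : 0 < Real.log ((k : ℝ) + 2) := Real.log_pos (by linarith)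
    have hμ : 0 < 1 - η * L := by linarith
    have hI : 0 ≤ ∫ ω, ‖X k ω - J (X k ω)‖ ^ 2 ∂Pr := integral_nonneg fun _ => by positivity
    have hN : 1734 * ((k : ℝ) + 2) ^ 3 * Real.log ((k : ℝ) + 2) ^ 2 ≤
        (1 - η * L) ^ 2 * innerIterations η L k := by
      rw [← div_le_iff₀' (by positivity)]
      exact Nat.le_ceil _
    -- Scaling by `α²` turns the distance to `J` into `‖R‖²`; the noise term only needs `α² ≤ 1`.
    have hα2 : α ^ 2 ≤ 1 := pow_le_one₀ hα0.le hα1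
    rw [← mul_div_assoc]
    refine div_le_div₀ (by positivity) ?_ (by positivity) hN
    have := mul_le_mul_of_nonneg_right hα2 (by positivity : 0 ≤ 24 * (η ^ 2 * σ ^ 2))
    linarith

end Expectations

/-! ### Complexity count and conclusion. -/

/-- The total number of inner iterations up to an outer iteration count of order `q`. -/
theorem sum_innerIterations_le {η L q Q : ℝ} (hηL : η * L < 1) (hηL0 : 0 ≤ η * L) (hq : 0 ≤ q)
    (hqQ : q ^ 4 ≤ 2 * Q) :
    2 * ∑ j ∈ Finset.range (max 1 ⌈6 * q⌉₊), (innerIterations η L j : ℝ) ≤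
      10 ^ 10 * ((1 + Q) / (1 - η * L) ^ 2) * Real.log (2 + Q) ^ 2 := by
  set K := max 1 ⌈6 * q⌉₊ with hK
  have hK1 : (1 : ℝ) ≤ K := by exact_mod_cast le_max_left _ _
  have hKq : (K : ℝ) + 1 ≤ 6 * q + 2 := by
    have : (K : ℝ) = max 1 (⌈6 * q⌉₊ : ℝ) := by rw [hK]; push_cast; rfl
    rw [this]
    have := Nat.ceil_lt_add_one (a := 6 * q) (by positivity)
    rcases max_cases (1 : ℝ) (⌈6 * q⌉₊ : ℝ) with h | h <;> linarith
  have hQ : 0 ≤ Q := by have : 0 ≤ q ^ 4 := by positivity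
                        linarith
  have hK4 : ((K : ℝ) + 1) ^ 4 ≤ 20736 * (1 + Q) := by
    have h1 : ((K : ℝ) + 1) ^ 4 ≤ (6 * q + 2) ^ 4 := by gcongr
    have h2 : (6 * q + 2) ^ 4 ≤ 8 * ((6 * q) ^ 4 + 2 ^ 4) := by
      have a1 : (6 * q + 2) ^ 2 ≤ 2 * ((6 * q) ^ 2 + 2 ^ 2) := by nlinarith [sq_nonneg (6 * q - 2)]
      have a2 : ((6 * q + 2) ^ 2) ^ 2 ≤ (2 * ((6 * q) ^ 2 + 2 ^ 2)) ^ 2 := by gcongr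
      nlinarith [sq_nonneg ((6 * q) ^ 2 - 2 ^ 2)]
    nlinarith
  have hμ : 0 < 1 - η * L := by linarith
  have hμ1 : (1 - η * L) ^ 2 ≤ 1 := pow_le_one₀ hμ.le (by linarith)
  have hl2 : (0.6931 : ℝ) < Real.log 2 := by have := Real.log_two_gt_d9; linarith
  have hlQ : Real.log 2 ≤ Real.log (2 + Q) := Real.log_le_log (by norm_num) (by linarith)
  -- Follows from `20736 ≤ 2 ^ 15`, by comparing fourth powers.
  have hlK : Real.log ((K : ℝ) + 1) ≤ 4 * Real.log (2 + Q) := by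
    have h1 : ((K : ℝ) + 1) ^ 4 ≤ (2 + Q) ^ 16 := by
      have : (20736 : ℝ) ≤ (2 + Q) ^ 15 :=
        le_trans (by norm_num) (pow_le_pow_left₀ (by norm_num : (0 : ℝ) ≤ 2) (by linarith) 15)
      calc ((K : ℝ) + 1) ^ 4 ≤ 20736 * (1 + Q) := hK4
        _ ≤ (2 + Q) ^ 15 * (2 + Q) := by gcongr; norm_num
        _ = _ := by ring
    have h2 := Real.log_le_log (by positivity) h1
    rw [Real.log_pow, Real.log_pow] at h2
    push_cast at h2
    linarith
  have hlK0 : 0 ≤ Real.log ((K : ℝ) + 1) := Real.log_nonneg (by linarith)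
  set l := Real.log (2 + Q)
  -- Here `27747 = 1734 · 4² + 3`, the `3` absorbing the rounding of the ceiling.
  have hterm : ∀ j ∈ Finset.range K, (innerIterations η L j : ℝ) ≤
      27747 * ((K : ℝ) + 1) ^ 3 * l ^ 2 / (1 - η * L) ^ 2 := by
    intro j hj
    have hjK : (j : ℝ) + 1 ≤ K := by exact_mod_cast Finset.mem_range.1 hj
    have hj0 : (0 : ℝ) ≤ j := j.cast_nonneg
    have hlj0 : 0 ≤ Real.log ((j : ℝ) + 2) := Real.log_nonneg (by linarith)
    have hlj : Real.log ((j : ℝ) + 2) ≤ 4 * l :=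
      (Real.log_le_log (by positivity) (by linarith)).trans hlK
    have h1 : (innerIterations η L j : ℝ) ≤
        1734 * ((j : ℝ) + 2) ^ 3 * Real.log ((j : ℝ) + 2) ^ 2 / (1 - η * L) ^ 2 + 1 :=
      (Nat.ceil_lt_add_one (by positivity)).le
    have h2 : 1734 * ((j : ℝ) + 2) ^ 3 * Real.log ((j : ℝ) + 2) ^ 2 / (1 - η * L) ^ 2 ≤
        1734 * ((K : ℝ) + 1) ^ 3 * (4 * l) ^ 2 / (1 - η * L) ^ 2 := by
      have : (j : ℝ) + 2 ≤ K + 1 := by linarith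
      gcongr
    have h3 : 1 ≤ 3 * ((K : ℝ) + 1) ^ 3 * l ^ 2 / (1 - η * L) ^ 2 := by
      rw [le_div_iff₀ (by positivity), one_mul]
      refine hμ1.trans ?_
      have a1 : (8 : ℝ) ≤ ((K : ℝ) + 1) ^ 3 :=
        le_trans (by norm_num) (pow_le_pow_left₀ (by norm_num : (0 : ℝ) ≤ 2) (by linarith) 3)
      have a2 : (0.48 : ℝ) ≤ l ^ 2 := by nlinarith
      nlinarith
    refine h1.trans ((add_le_add h2 h3).trans_eq ?_)
    ring
  have hsum := Finset.sum_le_card_nsmul _ _ _ hterm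
  rw [Finset.card_range, nsmul_eq_mul] at hsum
  have h4 : (K : ℝ) * (27747 * ((K : ℝ) + 1) ^ 3 * l ^ 2 / (1 - η * L) ^ 2) ≤
      27747 * ((K : ℝ) + 1) ^ 4 * l ^ 2 / (1 - η * L) ^ 2 := by
    rw [← mul_div_assoc]
    gcongr ?_ / _
    have : 0 ≤ 27747 * ((K : ℝ) + 1) ^ 3 * l ^ 2 := by positivity
    nlinarith
  have h5 : 27747 * ((K : ℝ) + 1) ^ 4 * l ^ 2 / (1 - η * L) ^ 2 ≤
      27747 * (20736 * (1 + Q)) * l ^ 2 / (1 - η * L) ^ 2 := by gcongr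
  have h6 : 10 ^ 10 * ((1 + Q) / (1 - η * L) ^ 2) * l ^ 2 =
      10 ^ 10 * ((1 + Q) * l ^ 2 / (1 - η * L) ^ 2) := by ring
  have h7 : 27747 * (20736 * (1 + Q)) * l ^ 2 / (1 - η * L) ^ 2 =
      27747 * 20736 * ((1 + Q) * l ^ 2 / (1 - η * L) ^ 2) := by ring
  have h8 : 0 ≤ (1 + Q) * l ^ 2 / (1 - η * L) ^ 2 := by positivity
  rw [h6]
  linarith

theorem theoremC2 :
    ∃ C : ℝ, 0 < C ∧
      ∀ (d : ℕ) (Ω : Type*) [MeasurableSpace Ω] (Pr : Measure Ω) [IsProbabilityMeasure Pr]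
        (S : Type*) [MeasurableSpace S] (P : Measure S)
        (F : EuclideanSpace ℝ (Fin d) → EuclideanSpace ℝ (Fin d))
        (G : EuclideanSpace ℝ (Fin d) → Set (EuclideanSpace ℝ (Fin d)))
        (Ft : EuclideanSpace ℝ (Fin d) → S → EuclideanSpace ℝ (Fin d))
        (ξ : ℕ → Ω → S) (L : ℝ≥0) (ρ η σ : ℝ) (x₀ xstar : EuclideanSpace ℝ (Fin d)),
        LipschitzWith L F →
        IsMaximallyMonotone G →
        0 ∈ sumOperator F G xstar →
        0 < ρ →
        IsMaximallyCohypomonotone ρ (sumOperator F G) →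
        0 ≤ σ →
        IsStochasticOracle P F Ft σ →
        (∀ n, Measurable (ξ n)) →
        (∀ n, Pr.map (ξ n) = P) →
        iIndepFun ξ Pr →
        η * L < 1 →
        ρ < η →
        -- all resolvents that occur are defined everywhere and single-valued
        (∀ x, ∃! y, IsResolventValue (scaleOperator η (sumOperator F G)) x y) ∧
        (∀ c : ℝ, 0 < c → ∀ x, ∃! y, IsResolventValue (scaleOperator c (scaleOperator η G)) x y) ∧
        -- rate of the last iterate
        (∀ k : ℕ, 1 ≤ k →
          Integrable (fun ω =>
            ‖(stochasticHalpern G Ft η L ρ x₀ (fun n => ξ n ω) k).point -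
              operatorResolvent (scaleOperator η (sumOperator F G))
                (stochasticHalpern G Ft η L ρ x₀ (fun n => ξ n ω) k).point‖ ^ 2) Pr ∧
          1 / η ^ 2 * ∫ ω,
            ‖(stochasticHalpern G Ft η L ρ x₀ (fun n => ξ n ω) k).point -
              operatorResolvent (scaleOperator η (sumOperator F G))
                (stochasticHalpern G Ft η L ρ x₀ (fun n => ξ n ω) k).point‖ ^ 2 ∂Pr ≤
            36 * (‖x₀ - xstar‖ ^ 2 + η ^ 2 * σ ^ 2) / ((η - ρ) ^ 2 * (k : ℝ) ^ 2)) ∧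
        -- oracle calls made at outer iteration `k`
        (∀ (k : ℕ) (seeds : ℕ → S),
          (stochasticHalpern G Ft η L ρ x₀ seeds (k + 1)).evals ≤
            (stochasticHalpern G Ft η L ρ x₀ seeds k).evals +
              2 * ⌈1734 * ((k : ℝ) + 2) ^ 3 * Real.log ((k : ℝ) + 2) ^ 2 / (1 - η * L) ^ 2⌉₊ ∧
          (stochasticHalpern G Ft η L ρ x₀ seeds (k + 1)).resolvents ≤
            (stochasticHalpern G Ft η L ρ x₀ seeds k).resolvents +
              ⌈1734 * ((k : ℝ) + 2) ^ 3 * Real.log ((k : ℝ) + 2) ^ 2 / (1 - η * L) ^ 2⌉₊) ∧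
        -- total oracle complexity
        (∀ ε : ℝ, 0 < ε → ∃ K : ℕ, 1 ≤ K ∧
          Integrable (fun ω =>
            ‖(stochasticHalpern G Ft η L ρ x₀ (fun n => ξ n ω) K).point -
              operatorResolvent (scaleOperator η (sumOperator F G))
                (stochasticHalpern G Ft η L ρ x₀ (fun n => ξ n ω) K).point‖) Pr ∧
          ∫ ω, η⁻¹ *
            ‖(stochasticHalpern G Ft η L ρ x₀ (fun n => ξ n ω) K).point -
              operatorResolvent (scaleOperator η (sumOperator F G))
                (stochasticHalpern G Ft η L ρ x₀ (fun n => ξ n ω) K).point‖ ∂Pr ≤ ε ∧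
          ∀ seeds : ℕ → S,
            (max (stochasticHalpern G Ft η L ρ x₀ seeds K).evals
                (stochasticHalpern G Ft η L ρ x₀ seeds K).resolvents : ℝ) ≤
              C * ((1 + (‖x₀ - xstar‖ ^ 4 + η ^ 4 * σ ^ 4) / ((η - ρ) ^ 4 * ε ^ 4)) /
                    (1 - η * L) ^ 2) *
                Real.log
                  (2 + (‖x₀ - xstar‖ ^ 4 + η ^ 4 * σ ^ 4) / ((η - ρ) ^ 4 * ε ^ 4)) ^ 2) := by
  refine ⟨10 ^ 10, by norm_num, ?_⟩
  intro d Ω _ Pr _ S _ P F G Ft ξ L ρ η σ x₀ xstar hF hG hstar hρ hFG hσ hO hξ hP hind hηL hρη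
  have hη : 0 < η := hρ.trans hρη
  have hηρ : 0 < η - ρ := sub_pos.2 hρη
  have hL0 : 0 ≤ η * (L : ℝ) := by positivity
  have hrate := stochasticHalpern_rate (x₀ := x₀) hF hG hstar hFG.1 hO hξ hP hind hρ.le hηL hρη
    rfl rfl
  set W : ℝ := ‖x₀ - xstar‖ ^ 2 + η ^ 2 * σ ^ 2 with hW
  have hW0 : 0 ≤ W := by positivity
  have hrate' : ∀ k : ℕ, 1 ≤ k → 1 / η ^ 2 * ∫ ω,
      ‖(stochasticHalpern G Ft η L ρ x₀ (fun n => ξ n ω) k).point -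
        operatorResolvent (scaleOperator η (sumOperator F G))
          (stochasticHalpern G Ft η L ρ x₀ (fun n => ξ n ω) k).point‖ ^ 2 ∂Pr ≤
      36 * W / ((η - ρ) ^ 2 * (k : ℝ) ^ 2) := by
    intro k hk
    have hk0 : (0 : ℝ) < k := by exact_mod_cast hk
    refine (mul_le_mul_of_nonneg_left (hrate k).2 (by positivity)).trans ?_
    have e : 1 / η ^ 2 * (η ^ 2 / (η - ρ) ^ 2 * (36 * W / (((k : ℝ) + 1) * (k + 2)))) =
        36 * W / ((η - ρ) ^ 2 * (((k : ℝ) + 1) * (k + 2))) := by field_simp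
    rw [e]
    gcongr
    nlinarith
  refine ⟨hG.existsUnique_isResolventValue_sumOperator hF hη hηL, ?_, ?_, ?_, ?_⟩
  · intro c hc x
    rw [scaleOperator_scaleOperator]
    exact hG.existsUnique_isResolventValue (mul_pos hc hη) x
  · exact fun k hk => ⟨memLp_two_integrable_norm_sq (hrate k).1, hrate' k hk⟩
  · intro k seeds
    obtain ⟨h1, h2⟩ := stochasticHalpern_counters G Ft η L ρ x₀ seeds k
    obtain ⟨h3, h4⟩ := stochasticHalpern_counters G Ft η L ρ x₀ seeds (k + 1)
    rw [h1, h2, h3, h4, Finset.sum_range_succ, mul_add]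
    exact ⟨le_rfl, le_rfl⟩
  · intro ε hε
    -- The rate `6 √W / ((η - ρ) K)` for the root mean square is at most `ε` once `K ≥ 6 q`; the
    -- `max 1` below covers `W = 0`.
    set q : ℝ := √W / ((η - ρ) * ε) with hq
    have hq0 : 0 ≤ q := by positivity
    have hq2 : W = q ^ 2 * ((η - ρ) * ε) ^ 2 := by
      rw [hq, div_pow, Real.sq_sqrt hW0]
      field_simp
    have hqQ : q ^ 4 ≤
        2 * ((‖x₀ - xstar‖ ^ 4 + η ^ 4 * σ ^ 4) / ((η - ρ) ^ 4 * ε ^ 4)) := by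
      rw [← mul_div_assoc, le_div_iff₀ (by positivity)]
      have : q ^ 4 * ((η - ρ) ^ 4 * ε ^ 4) = W ^ 2 := by rw [hq2]; ring
      rw [this, hW]
      nlinarith [sq_nonneg (‖x₀ - xstar‖ ^ 2 - η ^ 2 * σ ^ 2)]
    set K : ℕ := max 1 ⌈6 * q⌉₊ with hK
    have hK1 : 1 ≤ K := le_max_left _ _
    have hKq : 6 * q ≤ K := (Nat.le_ceil _).trans (by exact_mod_cast le_max_right _ _)
    have hK0 : (0 : ℝ) < K := by exact_mod_cast hK1
    have hLp := (hrate K).1.norm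
    refine ⟨K, hK1, hLp.integrable (by norm_num), ?_, fun seeds => ?_⟩
    · rw [integral_const_mul, inv_mul_le_iff₀ hη]
      -- Jensen: the squared mean is at most the mean square.
      refine (abs_le_of_sq_le_sq' ?_ (by positivity : 0 ≤ η * ε)).2
      refine (sq_integral_le_integral_sq hLp).trans ?_
      have h1 := hrate' K hK1
      rw [one_div, inv_mul_le_iff₀ (by positivity)] at h1
      refine h1.trans ?_
      rw [mul_pow]
      refine mul_le_mul_of_nonneg_left ?_ (by positivity)
      rw [div_le_iff₀ (by positivity), hq2]
      have h2 : (6 * q) ^ 2 ≤ (K : ℝ) ^ 2 := by gcongr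
      have h3 := mul_le_mul_of_nonneg_right h2 (sq_nonneg ((η - ρ) * ε))
      nlinarith
    · obtain ⟨h1, h2⟩ := stochasticHalpern_counters G Ft η L ρ x₀ seeds K
      have h3 := sum_innerIterations_le hηL hL0 hq0 hqQ
      rw [h1, h2]
      push_cast
      refine (max_le le_rfl ?_).trans h3
      have : 0 ≤ ∑ j ∈ Finset.range K, (innerIterations η L j : ℝ) :=
        Finset.sum_nonneg fun _ _ => Nat.cast_nonneg _
      linarith
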